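/- One-dimensional Peg Solitaire is played on the infinite line of cells $\mathbb{Z}$, finitely many of which hold a peg, the others being holes. A move takes a peg on a cell $p$ whose neighbour $p+d$ ($d=\pm1$) holds a peg and for which $p+2d$ is a hole, puts it on $p+2d$, and removes the peg on $p+d$. A string $c_0c_1\ldots c_{n-1}\in\{0,1\}^n$ denotes the configuration with pegs exactly on the cells $i$ with $0\le i<n$ and $c_i=1$. Theorem 2. There is a linear-time strategy for reducing any one-dimensional Peg Solitaire configuration to the minimum possible number of pegs. That is, there are a random access machine program (unit cost per instruction, with words of $O(\log n)$ bits) and a constant $C$ such that, for every $n\ge 0$ and every input string $c_0c_1\ldots c_{n-1}\in\{0,1\}^n$, the program halts after at most $C(n+1)$ steps and outputs the minimum number $k$ of pegs to which the configuration can be reduced by a sequence of moves, followed by an explicit sequence of legal moves (source and target cell of each) that reduces the configuration to exactly $k$ pegs. -/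

import Mathlib

/-! ### One-dimensional Peg Solitaire on the infinite line of cells `ℤ` -/

namespace PegSolitaire

/-- A configuration is the finite set of cells that hold a peg; all other cells are holes. -/
abbrev Config := Finset ℤ

/-- A move is recorded as `(source cell, target cell)` of the hopping peg. -/
abbrev Move := ℤ × ℤ

/-- `IsHop c m c'`: in `c`, the peg on cell `m.1` may hop over an adjacent peg into the hole
`m.2` just behind it, the peg hopped over is removed, and the outcome is `c'`. -/
def IsHop (c : Config) (m : Move) (c' : Config) : Prop :=
  ∃ d : ℤ, (d = 1 ∨ d = -1) ∧ m.2 = m.1 + 2 * d ∧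
    m.1 ∈ c ∧ m.1 + d ∈ c ∧ m.2 ∉ c ∧
    c' = insert m.2 ((c.erase m.1).erase (m.1 + d))

/-- `Plays c ms c'`: the moves `ms`, made in this order from `c`, are all legal and lead to
`c'`. -/
inductive Plays : Config → List Move → Config → Prop
  | nil (c : Config) : Plays c [] c
  | cons {c c₁ c₂ : Config} {m : Move} {ms : List Move} :
      IsHop c m c₁ → Plays c₁ ms c₂ → Plays c (m :: ms) c₂

/-- `c` can be reduced to exactly `k` pegs. -/
def ReducibleTo (c : Config) (k : ℕ) : Prop :=
  ∃ (ms : List Move) (c' : Config), Plays c ms c' ∧ c'.card = k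

/-- The configuration given by a string `w` of pegs (`true`) and holes (`false`), written on the
cells `0, …, w.length - 1`, with holes on all other cells of the line. -/
def ofString (w : List Bool) : Config :=
  ((Finset.range w.length).filter (fun i => w[i]? = some true)).image (fun i : ℕ => (i : ℤ))

end PegSolitaire

/-! ### A random access machine with unit-cost instructions

Registers and array entries hold integers. The only arithmetic is `+ 1` and `- 1`, so that in `t`
steps on an input of length `n` no number of absolute value above `n + t + const` can arise: linear
time on this machine is linear time with words of `O(log n)` bits. A program mentions only
finitely many registers and arrays. -/

namespace RAM

/-- Comparisons of two registers. -/
inductive Test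
  | eq (x y : ℕ)
  | lt (x y : ℕ)

/-- Programs. Natural numbers are names of registers and of arrays. -/
inductive Prog
  /-- do nothing -/
  | skip
  /-- `x := v` for a constant `v` -/
  | const (x : ℕ) (v : ℤ)
  /-- `x := y` -/
  | copy (x y : ℕ)
  /-- `x := x + 1` -/
  | incr (x : ℕ)
  /-- `x := x - 1` -/
  | decr (x : ℕ)
  /-- `x := A[i]` -/
  | load (x A i : ℕ)
  /-- `A[i] := x` -/
  | store (A i x : ℕ)
  /-- append the content of `x` to the output tape -/
  | emit (x : ℕ)
  | seq (p q : Prog)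
  | ite (b : Test) (p q : Prog)
  | while (b : Test) (p : Prog)

/-- The state of the machine: registers, arrays, and the write-only output tape. -/
structure State where
  reg : ℕ → ℤ
  arr : ℕ → ℤ → ℤ
  out : List ℤ

/-- The truth value of a comparison. -/
def Test.Holds (s : State) : Test → Prop
  | .eq x y => s.reg x = s.reg y
  | .lt x y => s.reg x < s.reg y

/-- Write `v` into register `x`. -/
def State.setReg (s : State) (x : ℕ) (v : ℤ) : State :=
  { s with reg := Function.update s.reg x v }

/-- Write `v` into entry `i` of array `A`. -/
def State.setArr (s : State) (A : ℕ) (i v : ℤ) : State :=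
  { s with arr := Function.update s.arr A (Function.update (s.arr A) i v) }

/-- `Exec p s s' t`: the program `p`, started in state `s`, halts in state `s'` after `t` steps.
Every instruction and every evaluation of a comparison is one step. -/
inductive Exec : Prog → State → State → ℕ → Prop
  | skip (s : State) : Exec .skip s s 1
  | const (s : State) (x : ℕ) (v : ℤ) : Exec (.const x v) s (s.setReg x v) 1
  | copy (s : State) (x y : ℕ) : Exec (.copy x y) s (s.setReg x (s.reg y)) 1
  | incr (s : State) (x : ℕ) : Exec (.incr x) s (s.setReg x (s.reg x + 1)) 1
  | decr (s : State) (x : ℕ) : Exec (.decr x) s (s.setReg x (s.reg x - 1)) 1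
  | load (s : State) (x A i : ℕ) : Exec (.load x A i) s (s.setReg x (s.arr A (s.reg i))) 1
  | store (s : State) (A i x : ℕ) :
      Exec (.store A i x) s (s.setArr A (s.reg i) (s.reg x)) 1
  | emit (s : State) (x : ℕ) : Exec (.emit x) s { s with out := s.out ++ [s.reg x] } 1
  | seq {p q : Prog} {s s₁ s₂ : State} {t₁ t₂ : ℕ} :
      Exec p s s₁ t₁ → Exec q s₁ s₂ t₂ → Exec (.seq p q) s s₂ (t₁ + t₂)
  | iteTrue {b : Test} {p q : Prog} {s s' : State} {t : ℕ} :
      b.Holds s → Exec p s s' t → Exec (.ite b p q) s s' (t + 1)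
  | iteFalse {b : Test} {p q : Prog} {s s' : State} {t : ℕ} :
      ¬ b.Holds s → Exec q s s' t → Exec (.ite b p q) s s' (t + 1)
  | whileTrue {b : Test} {p : Prog} {s s₁ s₂ : State} {t₁ t₂ : ℕ} :
      b.Holds s → Exec p s s₁ t₁ → Exec (.while b p) s₁ s₂ t₂ →
      Exec (.while b p) s s₂ (t₁ + t₂ + 1)
  | whileFalse {b : Test} {p : Prog} {s : State} :
      ¬ b.Holds s → Exec (.while b p) s s 1

/-- The initial state on the input string `w`: register `0` holds its length, array `0` holds its
symbols (`1` for `true`, `0` for `false`) at the indices `0, …, w.length - 1`, everything else is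
`0`, and the output tape is empty. -/
def init (w : List Bool) : State where
  reg := fun x => if x = 0 then (w.length : ℤ) else 0
  arr := fun A i => if A = 0 ∧ 0 ≤ i ∧ w[i.toNat]? = some true then 1 else 0
  out := []

end RAM

namespace PegSolitaire

/-- A number `k` and a list of moves as written on the output tape: first `k`, then source and
target cell of each move in turn. -/
def encodeOutput (k : ℕ) (ms : List Move) : List ℤ :=
  (k : ℤ) :: ms.flatMap (fun m => [m.1, m.2])

end PegSolitaire

/-! The minimum number of pegs equals the least cost of an accepting path through the finite
weighted automaton `Q`, which cuts the string into blocks and charges one per block.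

Lower bound. Call a string solvable if the deterministic automaton `R` accepts it. Reducibility of
these strings to one peg is never used for this bound; what matters is closure under undoing a hop.
This is a finite check: `R.le` is a simulation order, and from every state the three cells after a
hop lead to a state below the one reached by the three cells before it (`Solvable.unhop`). Cuts into
`k` solvable blocks survive as well, even if the hop straddles a cut (`Splits.unhop`). A final
position with `k` pegs splits into `k` single-peg blocks, so going back through the play splits the
initial string into `k` solvable blocks (`Splits.of_plays`). Every such cut yields a path of `Q` of
cost `k` (`Run.of_splits`).

Upper bound. Every accepting path is a recipe for moves. In a typical long block a pair `11` at the
right end travels left over cells `10`, a pair `11` at the left end travels right over cells `01`,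
and a middle piece joins them. All leftward travel can be done in one sweep from right to left, the
rest in one sweep from left to right; each transition of `Q` contributes boundedly many moves,
checked on short strings (`Path.plays_sweeps`). Exactly one peg per unit of cost remains.

Algorithm. Least costs are computed by dynamic programming from the right end, a cheapest path is
then followed from the left, and the two sweeps are written out. Each pass does a bounded amount of
work per cell. -/

namespace PegSolitaire

/-! ### Strings as configurations, and hops inside a string -/

/-- The configuration given by the string `w`, written from cell `a` on. -/
def cells (a : ℤ) : List Bool → Config
  | [] => ∅
  | true :: w => insert a (cells (a + 1) w)
  | false :: w => cells (a + 1) w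

theorem mem_cells {z a : ℤ} {w : List Bool} :
    z ∈ cells a w ↔ ∃ j : ℕ, w[j]? = some true ∧ z = a + j := by
  induction w generalizing a with
  | nil => simp [cells]
  | cons b w ih =>
    have key : (∃ j : ℕ, (b :: w)[j]? = some true ∧ z = a + j) ↔
        (b = true ∧ z = a) ∨ ∃ j : ℕ, w[j]? = some true ∧ z = a + 1 + j := by
      constructor
      · rintro ⟨j, hj, rfl⟩
        cases j with
        | zero => left; simpa using hj
        | succ j => right; exact ⟨j, by simpa using hj, by push_cast; ring⟩
      · rintro (⟨rfl, rfl⟩ | ⟨j, hj, rfl⟩)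
        · exact ⟨0, by simp⟩
        · exact ⟨j + 1, by simpa using hj, by push_cast; ring⟩
    rw [key]
    cases b <;> simp [cells, ih]

theorem ofString_eq_cells (w : List Bool) : ofString w = cells 0 w := by
  ext z
  simp only [ofString, mem_cells, Finset.mem_image, Finset.mem_filter, Finset.mem_range, zero_add]
  constructor
  · rintro ⟨j, ⟨_, h⟩, rfl⟩
    exact ⟨j, h, rfl⟩
  · rintro ⟨j, h, rfl⟩
    refine ⟨j, ⟨?_, h⟩, rfl⟩
    by_contra hlt
    rw [List.getElem?_eq_none (by omega)] at h
    cases h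

theorem cells_append (a : ℤ) (u v : List Bool) :
    cells a (u ++ v) = cells a u ∪ cells (a + u.length) v := by
  induction u generalizing a with
  | nil => simp [cells]
  | cons b u ih =>
    have h : a + 1 + (u.length : ℤ) = a + ((u.length + 1 : ℕ) : ℤ) := by push_cast; ring
    cases b <;> simp only [List.cons_append, cells, ih, List.length_cons, h, Finset.insert_union]

theorem le_of_mem_cells {z a : ℤ} {w : List Bool} (h : z ∈ cells a w) : a ≤ z := by
  obtain ⟨j, _, rfl⟩ := mem_cells.1 h
  omega

theorem lt_of_mem_cells {z a : ℤ} {w : List Bool} (h : z ∈ cells a w) : z < a + w.length := by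
  obtain ⟨j, hj, rfl⟩ := mem_cells.1 h
  by_contra hlt
  rw [List.getElem?_eq_none (by omega)] at hj
  cases hj

theorem card_cells (a : ℤ) (w : List Bool) : (cells a w).card = w.count true := by
  induction w generalizing a with
  | nil => simp [cells]
  | cons b w ih =>
    cases b
    · simpa [cells] using ih (a + 1)
    · rw [cells, Finset.card_insert_of_notMem, ih]
      · simp
      · intro h
        have := le_of_mem_cells h
        omega

theorem isHop_right (a : ℤ) (x y : List Bool) :
    IsHop (cells a (x ++ [true, true, false] ++ y)) (a + x.length, a + x.length + 2)
      (cells a (x ++ [false, false, true] ++ y)) := by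
  simp only [cells_append, cells, IsHop, List.length_append, List.length_cons, List.length_nil]
  have h₁ : ∀ z ∈ cells a x, z < a + x.length := fun z => lt_of_mem_cells
  have h₂ : ∀ z ∈ cells (a + ((x.length + (0 + 1 + 1 + 1) : ℕ) : ℤ)) y, a + x.length + 3 ≤ z := by
    intro z hz
    have := le_of_mem_cells hz
    push_cast at this
    omega
  refine ⟨1, Or.inl rfl, by simp, by simp, by simp, ?_, ?_⟩
  · simp only [Finset.mem_union, Finset.mem_insert, Finset.notMem_empty]
    grind
  · ext z
    simp only [Finset.mem_union, Finset.mem_insert, Finset.notMem_empty, Finset.mem_erase]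
    grind

theorem isHop_left (a : ℤ) (x y : List Bool) :
    IsHop (cells a (x ++ [false, true, true] ++ y)) (a + x.length + 2, a + x.length)
      (cells a (x ++ [true, false, false] ++ y)) := by
  simp only [cells_append, cells, IsHop, List.length_append, List.length_cons, List.length_nil]
  have h₁ : ∀ z ∈ cells a x, z < a + x.length := fun z => lt_of_mem_cells
  have h₂ : ∀ z ∈ cells (a + ((x.length + (0 + 1 + 1 + 1) : ℕ) : ℤ)) y, a + x.length + 3 ≤ z := by
    intro z hz
    have := le_of_mem_cells hz
    push_cast at this
    omega
  refine ⟨-1, Or.inr rfl, by simp, ?_, ?_, ?_, ?_⟩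
  · simp only [Finset.mem_union, Finset.mem_insert, Finset.notMem_empty]
    grind
  · simp only [Finset.mem_union, Finset.mem_insert, Finset.notMem_empty]
    grind
  · simp only [Finset.mem_union, Finset.mem_insert, Finset.notMem_empty]
    grind
  · ext z
    simp only [Finset.mem_union, Finset.mem_insert, Finset.notMem_empty, Finset.mem_erase]
    grind

theorem Plays.append {c c₁ c₂ : Config} {ms ms' : List Move} (h : Plays c ms c₁)
    (h' : Plays c₁ ms' c₂) : Plays c (ms ++ ms') c₂ := by
  induction h with
  | nil => exact h'
  | cons hop _ ih => exact .cons hop (ih h')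

/-- Translate a move by `i`. -/
def shift (i : ℤ) (m : Move) : Move := (i + m.1, i + m.2)

/-- A hop inside a finite string, with source and target given as indices. -/
def hopWord (u : List Bool) (s t : ℤ) : Option (List Bool) :=
  if 0 ≤ s ∧ t = s + 2 ∧ (u.drop s.toNat).take 3 = [true, true, false] then
    some (u.take s.toNat ++ [false, false, true] ++ u.drop (s.toNat + 3))
  else if 0 ≤ t ∧ s = t + 2 ∧ (u.drop t.toNat).take 3 = [false, true, true] then
    some (u.take t.toNat ++ [true, false, false] ++ u.drop (t.toNat + 3))
  else none

/-- Successive hops inside a finite string; the moves are relative to index `i`. -/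
def playWord (i : ℤ) : List Bool → List Move → Option (List Bool)
  | u, [] => some u
  | u, m :: ms => (hopWord u (i + m.1) (i + m.2)).bind fun v => playWord i v ms

theorem eq_take_append_drop {u l : List Bool} {n : ℕ} (h : (u.drop n).take 3 = l) :
    u = u.take n ++ l ++ u.drop (n + 3) := by
  rw [← h, List.append_assoc, ← List.drop_drop, List.take_append_drop, List.take_append_drop]

theorem length_take_of_take_drop {u l : List Bool} {n : ℕ} (h : (u.drop n).take 3 = l)
    (hl : l ≠ []) : (u.take n).length = n := by
  rw [List.length_take, min_eq_left]
  by_contra hlt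
  rw [List.drop_eq_nil_of_le (by omega)] at h
  exact hl (by simpa using h.symm)

theorem isHop_of_hopWord {u v : List Bool} {s t : ℤ} (h : hopWord u s t = some v) (a : ℤ)
    (x y : List Bool) :
    IsHop (cells a (x ++ u ++ y)) (a + x.length + s, a + x.length + t)
      (cells a (x ++ v ++ y)) := by
  unfold hopWord at h
  split_ifs at h with h₁ h₂
  · obtain ⟨hs, rfl, h₁⟩ := h₁
    have hl := length_take_of_take_drop h₁ (by simp)
    have key := isHop_right a (x ++ u.take s.toNat) (u.drop (s.toNat + 3) ++ y)
    simp only [Option.some.injEq] at h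
    subst h
    conv in (x ++ u ++ y) => rw [eq_take_append_drop h₁]
    rw [List.length_append, hl] at key
    push_cast [Int.toNat_of_nonneg hs] at key
    convert key using 2
    · simp only [List.append_assoc]
    · ring
    · ring
    · simp only [List.append_assoc]
  · obtain ⟨hs, rfl, h₂⟩ := h₂
    have hl := length_take_of_take_drop h₂ (by simp)
    have key := isHop_left a (x ++ u.take t.toNat) (u.drop (t.toNat + 3) ++ y)
    simp only [Option.some.injEq] at h
    subst h
    conv in (x ++ u ++ y) => rw [eq_take_append_drop h₂]
    rw [List.length_append, hl] at key
    push_cast [Int.toNat_of_nonneg hs] at key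
    convert key using 2
    · simp only [List.append_assoc]
    · ring
    · ring
    · simp only [List.append_assoc]

/-- A hop touches three cells only, so a play evaluated on a short string is legal in every context
`x`, `y`. This reduces the legality of the sweeps to finitely many evaluations of `playWord`. -/
theorem plays_of_playWord {i : ℤ} {u v : List Bool} {ms : List Move}
    (h : playWord i u ms = some v) (a : ℤ) (x y : List Bool) :
    Plays (cells a (x ++ u ++ y)) (ms.map (shift (a + x.length + i)))
      (cells a (x ++ v ++ y)) := by
  induction ms generalizing u with
  | nil =>
    simp only [playWord, Option.some.injEq] at h
    subst h
    exact .nil _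
  | cons m ms ih =>
    simp only [playWord, Option.bind_eq_some_iff] at h
    obtain ⟨u', h₁, h₂⟩ := h
    refine .cons ?_ (ih h₂)
    have := isHop_of_hopWord h₁ a x y
    simpa only [shift, add_assoc] using this

end PegSolitaire

namespace PegSolitaire

/-! ### The block automaton and the two sweeps of moves -/

/-- States of the weighted automaton that cuts a string into blocks reducible to one peg. -/
inductive Q
  | O | P | O1 | P1 | X | X0 | X1 | Y | Y1 | Z | Z1 | W | W0 | W1 | V | V1 | U | U0 | D
  deriving DecidableEq

namespace Q

/-- The two successors (possibly equal) of a state on reading a cell. -/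
def next : Q → Bool → Q × Q
  | O, true => (P, O1)
  | P, true => (P, P1)
  | O, false | P, false => (O, O)
  | O1, true => (X, O)
  | P1, true => (X, X)
  | O1, false | P1, false => (Y, Y)
  | X, true => (X1, X1)
  | X, false => (X0, X0)
  | X0, true => (X, O)
  | X0, false => (Y, Y)
  | X1, true => (W, U)
  | X1, false => (V, V)
  | Y, true => (Y1, Y1)
  | Y1, true => (Y, O)
  | Y1, false => (Z, Z)
  | Z, true => (Z1, Z1)
  | Z1, true => (O, O)
  | Z1, false => (Z, Z)
  | W, true => (W1, W1)
  | W, false => (W0, W0)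
  | W0, true => (O, O)
  | W0, false => (Z, Z)
  | W1, true => (W, W)
  | W1, false => (V, V)
  | V, true => (V1, V1)
  | V1, true => (Z, Z)
  | U, false => (U0, U0)
  | U0, true => (Y, Y)
  | _, _ => (D, D)

/-- Starting a block costs one. -/
def cost : Q → Bool → ℕ
  | O, true | P, true => 1
  | _, _ => 0

/-- The accepting states: those between two blocks. -/
def Final (q : Q) : Prop := q = O ∨ q = P

/-- Whether the last cell read is still to be paired with the next one. -/
def pending : Q → Bool
  | O1 | P1 | X0 | X1 | Y1 | Z1 | W0 | W1 | V1 | U0 => true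
  | _ => false

/-- The cells read but not yet paired. -/
def back : Q → List Bool
  | O1 | P1 | X1 | Y1 | Z1 | W1 | V1 => [true]
  | X0 | W0 | U0 => [false]
  | _ => []

/-- What the sweep to the left has brought in front of the part it has dealt with. -/
def brought : Q → List Bool
  | Z | Z1 => [true, true]
  | W | W0 | W1 => [false, true]
  | V | V1 => [true, true, true, true]
  | _ => []

/-- What the sweep to the right carries along. -/
def carry : Q → List Bool
  | X | X0 | X1 => [true, true]
  | U | U0 => [true, true, true, true]
  | Y | Y1 => [true, false]
  | P | P1 => []
  | _ => [false]

/-- The number of pegs that the current block will still contribute. -/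
def debt : Q → ℕ
  | O1 | P1 | X | X0 | X1 | U | U0 | Y | Y1 => 1
  | _ => 0

/-- The moves of the sweep to the left, relative to the cell read. -/
def leftMoves : Q → Q → List Move
  | Y1, Z | Z1, Z | W0, Z => [(2, 0)]
  | X1, V | W1, V => [(2, 0), (4, 2), (-1, 1), (2, 0)]
  | X1, W | W1, W => [(-1, 1), (2, 0)]
  | _, _ => []

/-- The moves of the sweep to the right, relative to the cell read. -/
def rightMoves : Q → Q → List Move
  | O1, O => [(0, -2)]
  | X0, X | X0, Y => [(-3, -1)]
  | U0, Y => [(-3, -1), (-5, -3), (0, -2), (-3, -1)]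
  | X0, O | X1, W | X1, V => [(-3, -1), (0, -2)]
  | Y1, Y | Y1, O | Y1, Z => [(0, -2), (-3, -1)]
  | _, _ => []

/-- The cells completed by a transition. -/
def completed (q : Q) (b : Bool) (r : Q) : List Bool :=
  if r.pending then [] else q.back ++ [b]

/-- What a transition contributes to the string left by the sweep to the left. -/
def swept (q : Q) (b : Bool) (r : Q) : List Bool :=
  ((playWord (q.back.length : ℤ) (completed q b r ++ r.brought) (leftMoves q r)).getD []).drop
    q.brought.length

/-- What a transition leaves behind in the sweep to the right. -/
def settled (q : Q) (b : Bool) (r : Q) : List Bool :=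
  let v := (playWord (q.carry.length + q.back.length - q.brought.length : ℤ)
    (q.carry ++ swept q b r) (rightMoves q r)).getD []
  v.take (v.length - r.carry.length)

/-- `r` is a successor of `q` on reading `b`. -/
def Step (q : Q) (b : Bool) (r : Q) : Prop := r = (q.next b).1 ∨ r = (q.next b).2

theorem back_append {q r : Q} {b : Bool} (h : Step q b r) (hr : r ≠ D) :
    q.back ++ [b] = completed q b r ++ r.back := by
  revert hr
  cases q <;> cases b <;> rcases h with rfl | rfl <;> decide

/-- An evaluation for each transition. It also certifies that the default `[]` in `swept` is never
used when `r ≠ D`; `playWord_rightMoves` does the same for `settled`. -/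
theorem playWord_leftMoves {q r : Q} {b : Bool} (h : Step q b r) (hr : r ≠ D) :
    playWord (q.back.length : ℤ) (completed q b r ++ r.brought) (leftMoves q r) =
      some (q.brought ++ swept q b r) := by
  revert hr
  cases q <;> cases b <;> rcases h with rfl | rfl <;> decide

theorem playWord_rightMoves {q r : Q} {b : Bool} (h : Step q b r) (hr : r ≠ D) :
    playWord (q.carry.length + q.back.length - q.brought.length : ℤ)
      (q.carry ++ swept q b r) (rightMoves q r) = some (settled q b r ++ r.carry) := by
  revert hr
  cases q <;> cases b <;> rcases h with rfl | rfl <;> decide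

/-- Amortised count of pegs: a block is paid for at its first peg, and `debt` records the payment
until the sweep to the right leaves the block's last peg behind. -/
theorem count_settled {q r : Q} {b : Bool} (h : Step q b r) (hr : r ≠ D) :
    (settled q b r).count true + r.debt = q.debt + q.cost b := by
  revert hr
  cases q <;> cases b <;> rcases h with rfl | rfl <;> decide

theorem length_settled {q r : Q} {b : Bool} (h : Step q b r) (hr : r ≠ D) :
    (settled q b r).length + r.carry.length + r.back.length + q.brought.length =
      q.carry.length + q.back.length + 1 + r.brought.length := by
  revert hr
  cases q <;> cases b <;> rcases h with rfl | rfl <;> decide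

/-- `Path q w rs k`: reading `w` from `q` the automaton may go through the states `rs`, ending in
an accepting one, at cost `k`. -/
inductive Path : Q → List Bool → List Q → ℕ → Prop
  | nil {q : Q} : Final q → Path q [] [] 0
  | cons {q r : Q} {b : Bool} {w : List Bool} {rs : List Q} {k : ℕ} :
      Step q b r → Path r w rs k → Path q (b :: w) (r :: rs) (q.cost b + k)

theorem Path.ne_D {q : Q} {w : List Bool} {rs : List Q} {k : ℕ} (h : Path q w rs k) : q ≠ D := by
  induction h with
  | nil h => rcases h with rfl | rfl <;> decide
  | @cons q r b w rs k hs _ ih =>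
    rintro rfl
    cases b <;> rcases hs with rfl | rfl <;> exact ih rfl

/-- The moves of the sweep to the left, for the cells from `i` on. -/
def leftSweep (i : ℤ) (q : Q) : List Q → List Move
  | [] => []
  | r :: rs => leftSweep (i + 1) r rs ++ (leftMoves q r).map (shift i)

/-- The moves of the sweep to the right, for the cells from `i` on. -/
def rightSweep (i : ℤ) (q : Q) : List Q → List Move
  | [] => []
  | r :: rs => (rightMoves q r).map (shift i) ++ rightSweep (i + 1) r rs

/-- Induction on the path, with a common string `rest` that the left sweep produces and the right
sweep consumes. The left sweep plays the later cells first, then the transition's own moves; the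
right sweep does the opposite. The offset `carry + back - brought` locates the cell being read
relative to the start of `rest`. The states `O` and `P` differ in that `O` carries a hole, into
which a following `11` can hop to the left. -/
theorem Path.plays_sweeps {q : Q} {w : List Bool} {rs : List Q} {k : ℕ} (h : Path q w rs k) :
    ∃ rest : List Bool,
      (∀ (a : ℤ) (x : List Bool), Plays (cells a (x ++ q.back ++ w))
        (leftSweep (a + x.length + q.back.length) q rs) (cells a (x ++ q.brought ++ rest))) ∧
      (∀ (a : ℤ) (x : List Bool), ∃ v : List Bool, Plays (cells a (x ++ q.carry ++ rest))
        (rightSweep (a + x.length + (q.carry.length + q.back.length - q.brought.length)) q rs)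
          (cells a (x ++ v)) ∧ v.count true = q.debt + k) := by
  induction h with
  | @nil q h =>
    refine ⟨[], ?_, ?_⟩
    · intro a x
      rcases h with rfl | rfl <;> exact .nil _
    · intro a x
      rcases h with rfl | rfl
      · exact ⟨[false], by simpa [carry, rightSweep] using Plays.nil _, rfl⟩
      · exact ⟨[], by simpa [carry, rightSweep] using Plays.nil _, rfl⟩
  | @cons q r b w rs k hs hp ih =>
    obtain ⟨rest, hl, hr⟩ := ih
    have hD := hp.ne_D
    have h₀ := back_append hs hD
    refine ⟨swept q b r ++ rest, ?_, ?_⟩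
    · intro a x
      have h₁ := hl a (x ++ completed q b r)
      have h₂ := plays_of_playWord (playWord_leftMoves hs hD) a x rest
      have hlen : (q.back.length : ℤ) + 1 = (completed q b r).length + r.back.length := by
        have := congrArg List.length h₀
        simp only [List.length_append, List.length_cons, List.length_nil] at this
        omega
      have e₁ : x ++ q.back ++ b :: w = x ++ completed q b r ++ r.back ++ w := by
        rw [List.append_assoc x (completed q b r), ← h₀]
        simp
      have e₂ : a + ((x ++ completed q b r).length : ℤ) + r.back.length =
          a + x.length + q.back.length + 1 := by
        rw [List.length_append]
        push_cast
        linarith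
      rw [e₁, leftSweep, ← e₂]
      refine h₁.append ?_
      simpa only [List.append_assoc] using h₂
    · intro a x
      obtain ⟨v, h₁, hv⟩ := hr a (x ++ settled q b r)
      have h₂ := plays_of_playWord (playWord_rightMoves hs hD) a x rest
      refine ⟨settled q b r ++ v, ?_, ?_⟩
      · have hlen := length_settled hs hD
        have e₂ : a + ((x ++ settled q b r).length : ℤ) +
            (r.carry.length + r.back.length - r.brought.length) =
            a + x.length + (q.carry.length + q.back.length - q.brought.length) + 1 := by
          rw [List.length_append]
          push_cast
          linarith
        rw [rightSweep, ← e₂]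
        refine Plays.append (c₁ := cells a (x ++ settled q b r ++ r.carry ++ rest)) ?_ ?_
        · simpa only [List.append_assoc] using h₂
        · simpa only [List.append_assoc] using h₁
      · have := count_settled hs hD
        rw [List.count_append, hv]
        omega

theorem Path.plays {w : List Bool} {rs : List Q} {k : ℕ} (h : Path O w rs k) :
    ∃ c, Plays (cells 0 w) (leftSweep 0 O rs ++ rightSweep 0 O rs) c ∧ c.card = k := by
  obtain ⟨rest, hl, hr⟩ := h.plays_sweeps
  -- The hole carried by `O` is the empty cell `-1`.
  obtain ⟨v, h₁, hv⟩ := hr (-1) []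
  have h₂ := hl 0 []
  refine ⟨_, h₂.append (c₁ := cells 0 rest) ?_, (card_cells (-1) v).trans (by simpa [debt] using hv)⟩
  simpa [cells, carry, back, brought] using h₁

end Q
end PegSolitaire

namespace PegSolitaire

/-! ### Solvable strings and reversed hops -/

/-- States of the automaton for the strings that can be reduced to a single peg, named by their
shortest inputs: `empty`, then binary words, with `sink` for `1001`. -/
inductive R
  | empty | r1 | r10 | r11 | r100 | r101 | r111 | r1010 | r1110 | r1111 | r10101 | r11101
  | r11111 | r111111 | sink
  deriving DecidableEq

namespace R

def next : R → Bool → R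
  | empty, false => empty
  | empty, true => r1
  | r1, false => r10
  | r1, true => r11
  | r10, false => r100
  | r10, true => r101
  | r11, false => r1
  | r11, true => r111
  | r100, false => r100
  | r101, false => r1010
  | r101, true => r10
  | r111, false => r1110
  | r111, true => r1111
  | r1010, true => r10101
  | r1110, true => r11101
  | r1111, false => r101
  | r1111, true => r11111
  | r10101, false => r1010
  | r10101, true => r100
  | r11101, true => r1010
  | r11111, false => r1110
  | r11111, true => r111111
  | r111111, false => r10101
  | r111111, true => r11111
  | _, _ => sink

def accepts : R → Bool
  | r1 | r10 | r11 | r100 => true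
  | _ => false

/-- The state after reading `w`. -/
def run (p : R) (w : List Bool) : R := w.foldl next p

/-- A simulation order: every string accepted from the smaller state is accepted from the
larger one. -/
def le : R → R → Bool
  | sink, _ | r1010, r10 | r1010, empty | r1110, r10 | r10101, r1 | r10101, r101 | r10101, empty
  | r11101, r101 | r11111, r1 | r11111, r111 | r111111, r11 | r111111, r1111 | r111111, empty
  | r100, r1 | r100, r10 | r100, r11 => true
  | p, q => p = q

theorem run_append (p : R) (u v : List Bool) : p.run (u ++ v) = (p.run u).run v :=
  List.foldl_append

theorem le_next {p q : R} (h : le p q) (b : Bool) : le (p.next b) (q.next b) := by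
  revert h
  cases p <;> cases q <;> cases b <;> decide

theorem accepts_of_le {p q : R} (h : le p q) (hp : p.accepts) : q.accepts := by
  revert h hp
  cases p <;> cases q <;> decide

theorem le_run {p q : R} (h : le p q) (w : List Bool) : le (p.run w) (q.run w) := by
  induction w generalizing p q with
  | nil => exact h
  | cons b w ih => exact ih (le_next h b)

end R

/-- The strings, padded with holes, that the automaton accepts. -/
def Solvable (w : List Bool) : Prop := (R.empty.run w).accepts = true

instance : DecidablePred Solvable := fun _ => inferInstanceAs (Decidable (_ = true))

/-- `Unhop u v`: a hop turns the three cells `v` into `u`. -/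
def Unhop (u v : List Bool) : Prop :=
  (u = [false, false, true] ∧ v = [true, true, false]) ∨
    (u = [true, false, false] ∧ v = [false, true, true])

/-- The prefix `x` matters only through the state it reaches, so comparing the states after `u` and
after `v` is a finite check; the simulation order then carries the comparison through `y`. -/
theorem Solvable.unhop {u v x y : List Bool} (huv : Unhop u v) (h : Solvable (x ++ u ++ y)) :
    Solvable (x ++ v ++ y) := by
  unfold Solvable at *
  rw [R.run_append, R.run_append] at *
  refine R.accepts_of_le (R.le_run ?_ y) h
  generalize R.empty.run x = p
  rcases huv with ⟨rfl, rfl⟩ | ⟨rfl, rfl⟩ <;> cases p <;> decide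

theorem solvable_append_false {w : List Bool} : Solvable (w ++ [false]) ↔ Solvable w := by
  unfold Solvable
  rw [R.run_append]
  generalize R.empty.run w = p
  cases p <;> decide

theorem solvable_cons_false {w : List Bool} : Solvable (false :: w) ↔ Solvable w := Iff.rfl

theorem not_solvable_nil : ¬ Solvable [] := by simp [Solvable, R.run, R.accepts]

/-! ### Cuts into solvable blocks and the lower bound -/

/-- `Splits w k`: `w` is a concatenation of `k` solvable strings, or consists of holes and
`k = 0`. -/
inductive Splits : List Bool → ℕ → Prop
  | holes {w : List Bool} : (∀ b ∈ w, b = false) → Splits w 0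
  | cons {u w : List Bool} {k : ℕ} : Solvable u → Splits w k → Splits (u ++ w) (k + 1)

namespace Splits

theorem cons_false {w : List Bool} {k : ℕ} (h : Splits w k) : Splits (false :: w) k := by
  cases h with
  | holes h => exact .holes (by simpa using h)
  | cons hu hw => exact .cons (u := false :: _) (solvable_cons_false.2 hu) hw

theorem of_cons_false {w : List Bool} {k : ℕ} (h : Splits (false :: w) k) : Splits w k := by
  generalize hv : false :: w = v at h
  cases h with
  | holes h =>
    subst hv
    exact .holes fun b hb => h b (List.mem_cons_of_mem _ hb)
  | @cons u w' k hu hw =>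
    cases u with
    | nil => exact absurd hu not_solvable_nil
    | cons b u =>
      obtain ⟨rfl, rfl⟩ := List.cons.inj hv
      exact .cons (solvable_cons_false.1 hu) hw

theorem of_append_false {w : List Bool} {k : ℕ} (h : Splits (w ++ [false]) k) : Splits w k := by
  generalize hv : w ++ [false] = v at h
  induction h generalizing w with
  | holes h =>
    subst hv
    exact .holes fun b hb => h b (List.mem_append_left _ hb)
  | @cons u w' k hu hw ih =>
    rcases List.eq_nil_or_concat w' with rfl | ⟨w'', b, rfl⟩
    · rw [List.append_nil] at hv
      subst hv
      simpa using Splits.cons (solvable_append_false.1 hu) hw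
    · rw [List.concat_eq_append, ← List.append_assoc] at hv
      obtain ⟨rfl, hb⟩ := List.append_inj' hv rfl
      refine .cons hu (ih ?_)
      rw [List.concat_eq_append, hb]

theorem count_true (w : List Bool) : Splits w (w.count true) := by
  induction w with
  | nil => exact .holes (by simp)
  | cons b w ih =>
    cases b
    · simpa using ih.cons_false
    · simpa using Splits.cons (u := [true]) rfl ih

/-- No block consists of holes only, so the first block contains all three cells and the hop is
undone inside it. -/
theorem unhop_head {y : List Bool} {k : ℕ} (h : Splits (false :: false :: true :: y) k) :
    Splits (true :: true :: false :: y) k := by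
  generalize hv : false :: false :: true :: y = v at h
  cases h with
  | holes h =>
    subst hv
    simpa using h true (by simp)
  | @cons u w k hu hw =>
    match u, hv with
    | [], _ => exact absurd hu not_solvable_nil
    | [b], hv =>
      obtain ⟨rfl, _⟩ := List.cons.inj hv
      exact absurd hu (by decide)
    | [b, c], hv =>
      simp only [List.cons_append, List.nil_append, List.cons.injEq] at hv
      obtain ⟨rfl, rfl, _⟩ := hv
      exact absurd hu (by decide)
    | b :: c :: d :: u, hv =>
      simp only [List.cons_append, List.cons.injEq] at hv
      obtain ⟨rfl, rfl, rfl, rfl⟩ := hv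
      exact .cons (u := true :: true :: false :: u)
        (Solvable.unhop (x := []) (.inl ⟨rfl, rfl⟩) hu) hw

/-- If the three cells lie within one block, `Solvable.unhop` applies. If a cut separates them,
holes are moved across the cut until one block contains all three; holes at the ends of a block are
free. -/
theorem unhop {u v x y : List Bool} {k : ℕ} (huv : Unhop u v) (h : Splits (x ++ u ++ y) k) :
    Splits (x ++ v ++ y) k := by
  generalize hz : x ++ u ++ y = z at h
  induction h generalizing x with
  | holes h =>
    subst hz
    rcases huv with ⟨rfl, rfl⟩ | ⟨rfl, rfl⟩ <;> simpa using h true (by simp)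
  | @cons u₁ w k hu hw ih =>
    rw [List.append_assoc] at hz
    rcases List.append_eq_append_iff.1 hz with ⟨c, rfl, hc⟩ | ⟨c, rfl, hc⟩
    · -- `u₁ = x ++ c`
      have inside : ∀ c', c = u ++ c' → Splits (x ++ v ++ y) (k + 1) := by
        rintro c' rfl
        rw [List.append_assoc] at hc
        rw [List.append_cancel_left hc, ← List.append_assoc]
        refine .cons (Solvable.unhop huv ?_) hw
        rwa [List.append_assoc]
      rcases huv with ⟨rfl, rfl⟩ | ⟨rfl, rfl⟩
      · match c, hc with
        | [], hc =>
          rw [List.append_nil] at hu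
          rw [List.append_assoc]
          exact .cons hu (ih (x := []) hc)
        -- The peg of `001` lies beyond the cut: the trailing hole of the block is handed over to
        -- the remainder, where all three cells now stand at the head.
        | [b], hc =>
          simp only [List.cons_append, List.nil_append, List.cons.injEq] at hc
          obtain ⟨rfl, rfl⟩ := hc
          rw [List.append_assoc]
          exact .cons (solvable_append_false.1 hu) hw.cons_false.unhop_head
        | [b, c], hc =>
          simp only [List.cons_append, List.nil_append, List.cons.injEq] at hc
          obtain ⟨rfl, rfl, rfl⟩ := hc
          rw [List.append_assoc]
          refine .cons ?_ hw.cons_false.cons_false.unhop_head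
          rwa [← solvable_append_false, ← solvable_append_false, List.append_assoc]
        | b :: c :: d :: c', hc =>
          refine inside c' ?_
          simp only [List.cons_append, List.nil_append, List.cons.injEq] at hc
          obtain ⟨rfl, rfl, rfl, _⟩ := hc
          rfl
      · match c, hc with
        | [], hc =>
          rw [List.append_nil] at hu
          rw [List.append_assoc]
          exact .cons hu (ih (x := []) hc)
        -- The peg of `100` lies before the cut: the block takes over the two holes at the head of
        -- the remainder.
        | [b], hc =>
          simp only [List.cons_append, List.nil_append, List.cons.injEq] at hc
          obtain ⟨rfl, rfl⟩ := hc
          refine .cons ?_ hw.of_cons_false.of_cons_false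
          have : Solvable (x ++ [true] ++ [false] ++ [false]) :=
            solvable_append_false.2 (solvable_append_false.2 hu)
          simpa using Solvable.unhop (u := [true, false, false]) (v := [false, true, true])
            (x := x) (y := []) (.inr ⟨rfl, rfl⟩) (by simpa using this)
        | [b, c], hc =>
          simp only [List.cons_append, List.nil_append, List.cons.injEq] at hc
          obtain ⟨rfl, rfl, rfl⟩ := hc
          refine .cons ?_ hw.of_cons_false
          have : Solvable (x ++ [true, false] ++ [false]) := solvable_append_false.2 hu
          simpa using Solvable.unhop (u := [true, false, false]) (v := [false, true, true])
            (x := x) (y := []) (.inr ⟨rfl, rfl⟩) (by simpa using this)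
        | b :: c :: d :: c', hc =>
          refine inside c' ?_
          simp only [List.cons_append, List.nil_append, List.cons.injEq] at hc
          obtain ⟨rfl, rfl, rfl, _⟩ := hc
          rfl
    · -- `x = u₁ ++ c`
      rw [List.append_assoc, List.append_assoc]
      refine .cons hu ?_
      rw [← List.append_assoc]
      refine ih ?_
      rw [hc, List.append_assoc]

end Splits

theorem IsHop.unique {c c₁ c₂ : Config} {m : Move} (h₁ : IsHop c m c₁) (h₂ : IsHop c m c₂) :
    c₁ = c₂ := by
  obtain ⟨d, _, hd, _, _, _, rfl⟩ := h₁
  obtain ⟨d', _, hd', _, _, _, rfl⟩ := h₂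
  obtain rfl : d = d' := by omega
  rfl

theorem cells_pad (a : ℤ) (w : List Bool) :
    cells (a - 2) ([false, false] ++ w ++ [false, false]) = cells a w := by
  simp only [cells_append, cells, List.length_cons, List.length_nil, Finset.empty_union,
    Finset.union_empty]
  congr 1
  push_cast
  ring

theorem add_mem_cells {a : ℤ} {w : List Bool} {j : ℕ} : a + j ∈ cells a w ↔ w[j]? = some true := by
  rw [mem_cells]
  constructor
  · rintro ⟨i, hi, h⟩
    obtain rfl : j = i := by omega
    exact hi
  · exact fun h => ⟨j, h, rfl⟩

theorem take_three_drop {w : List Bool} {j : ℕ} {b₀ b₁ b₂ : Bool} (h₀ : w[j]? = some b₀)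
    (h₁ : w[j + 1]? = some b₁) (h₂ : w[j + 2]? = some b₂) :
    (w.drop j).take 3 = [b₀, b₁, b₂] := by
  apply List.ext_getElem?
  intro i
  rw [List.getElem?_take]
  split_ifs with hi
  · rw [List.getElem?_drop]
    interval_cases i <;> simp [h₀, h₁, h₂]
  · simp only [not_lt] at hi
    rw [List.getElem?_eq_none (by simpa using hi)]

theorem getElem?_eq_false {w : List Bool} {j : ℕ} (hj : j < w.length) (h : w[j]? ≠ some true) :
    w[j]? = some false := by
  rw [List.getElem?_eq_getElem hj] at *
  cases hb : w[j]
  · rfl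
  · exact absurd (by rw [hb]) h

theorem exists_unhop_of_isHop {a : ℤ} {w : List Bool} {m : Move} {c : Config}
    (h : IsHop (cells a w) m c) (hl : a ≤ m.2) (hr : m.2 < a + w.length) :
    ∃ x y u v, Unhop u v ∧ w = x ++ v ++ y ∧ c = cells a (x ++ u ++ y) := by
  obtain ⟨s, t⟩ := m
  obtain ⟨d, hd, ht, h₀, h₁, h₂, -⟩ := id h
  simp only at ht hl hr h₀ h₁ h₂
  rcases hd with rfl | rfl
  · have hs := le_of_mem_cells h₀
    obtain ⟨j, rfl⟩ : ∃ j : ℕ, s = a + j := ⟨(s - a).toNat, by omega⟩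
    subst ht
    have e₀ := add_mem_cells.1 h₀
    have e₁ := (add_mem_cells (a := a) (w := w) (j := j + 1)).1 (by simpa [add_assoc] using h₁)
    have e₂ := getElem?_eq_false (w := w) (j := j + 2) (by omega) fun h' =>
      h₂ (by simpa [add_assoc] using (add_mem_cells (a := a)).2 h')
    have e := take_three_drop e₀ e₁ e₂
    refine ⟨_, _, _, _, .inl ⟨rfl, rfl⟩, eq_take_append_drop e, h.unique ?_⟩
    have key := isHop_right a (w.take j) (w.drop (j + 3))
    rw [← eq_take_append_drop e, length_take_of_take_drop e (by simp)] at key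
    simpa using key
  · obtain ⟨j, rfl⟩ : ∃ j : ℕ, t = a + j := ⟨(t - a).toNat, by omega⟩
    obtain rfl : s = a + j + 2 := by omega
    have e₀ := getElem?_eq_false (w := w) (j := j) (by omega) fun h' => h₂ (add_mem_cells.2 h')
    have e₁ := (add_mem_cells (a := a) (w := w) (j := j + 1)).1 (by
      convert h₁ using 1
      push_cast
      ring)
    have e₂ := (add_mem_cells (a := a) (w := w) (j := j + 2)).1 (by
      convert h₀ using 1
      push_cast
      ring)
    have e := take_three_drop e₀ e₁ e₂
    refine ⟨_, _, _, _, .inr ⟨rfl, rfl⟩, eq_take_append_drop e, h.unique ?_⟩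
    have key := isHop_left a (w.take j) (w.drop (j + 3))
    rw [← eq_take_append_drop e, length_take_of_take_drop e (by simp)] at key
    exact key

/-- Induction from the end of the play, where each peg is a block of its own, back to its start. -/
theorem Splits.of_plays {c c' : Config} {ms : List Move} (h : Plays c ms c') {a : ℤ}
    {w : List Bool} (hc : c = cells a w) : Splits w c'.card := by
  induction h generalizing a w with
  | nil c =>
    rw [hc, card_cells]
    exact .count_true w
  | @cons c c₁ c₂ m ms hop _ ih =>
    -- A hop lands at most two cells outside the string, so two holes of padding on each side
    -- suffice; they are stripped off again at the end.
    have hm : a - 2 ≤ m.2 ∧ m.2 < a + w.length + 2 := by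
      obtain ⟨d, hd, ht, h₀, -⟩ := hop
      rw [hc] at h₀
      have := le_of_mem_cells h₀
      have := lt_of_mem_cells h₀
      omega
    rw [hc, ← cells_pad] at hop
    obtain ⟨x, y, u, v, huv, hw, rfl⟩ := exists_unhop_of_isHop hop hm.1 (by
      simp only [List.length_append, List.length_cons, List.length_nil]
      push_cast
      omega)
    have := Splits.unhop huv (ih rfl)
    rw [← hw, List.append_assoc] at this
    refine (Splits.of_append_false (w := w ++ [false]) ?_).of_append_false
    simpa using this.of_cons_false.of_cons_false

end PegSolitaire

namespace PegSolitaire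
namespace Q

/-! ### From solvable blocks to paths of the block automaton -/

/-- `w` can be read from `q`, ending in an accepting state, at cost `k`. -/
def Run (q : Q) (w : List Bool) (k : ℕ) : Prop := ∃ rs, Path q w rs k

theorem Run.step {q r : Q} {w : List Bool} {k : ℕ} (h : Run r w k) (b : Bool)
    (hs : Step q b r := by first | exact .inl rfl | exact .inr rfl) :
    Run q (b :: w) (k + q.cost b) := by
  obtain ⟨rs, h⟩ := h
  exact ⟨r :: rs, add_comm k _ ▸ h.cons hs⟩

theorem Run.nil_O : Run O [] 0 := ⟨[], .nil (.inl rfl)⟩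

theorem Run.nil_P : Run P [] 0 := ⟨[], .nil (.inr rfl)⟩

theorem Run.cons_inv {q : Q} {b : Bool} {w : List Bool} {k : ℕ} (h : Run q (b :: w) k) :
    ∃ r k', Step q b r ∧ Run r w k' ∧ k = k' + q.cost b := by
  obtain ⟨rs, h⟩ := h
  cases h with
  | cons hs h => exact ⟨_, _, hs, ⟨_, h⟩, add_comm _ _⟩

theorem Run.nil_inv {q : Q} {k : ℕ} (h : Run q [] k) : Final q ∧ k = 0 := by
  obtain ⟨rs, h⟩ := h
  cases h with
  | nil h => exact ⟨h, rfl⟩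

/-- A single peg may be put in front of any string as a block of its own. -/
theorem Run.cons_true : ∀ {w : List Bool} {k : ℕ}, Run O w k → Run O (true :: w) (k + 1)
  | [], k, h => by
    obtain ⟨-, rfl⟩ := h.nil_inv
    exact Run.nil_P.step true
  | false :: w, k, h => by
    obtain ⟨r, k', hs, hr, rfl⟩ := h.cons_inv
    obtain rfl : r = O := by rcases hs with rfl | rfl <;> rfl
    exact (hr.step (q := P) false).step (q := O) true
  | [true], k, h => by
    obtain ⟨r, k', hs, hr, rfl⟩ := h.cons_inv
    obtain ⟨-, rfl⟩ := hr.nil_inv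
    exact (Run.nil_P.step (q := P) true).step (q := O) true
  | true :: false :: w, k, h => by
    obtain ⟨r, k', hs, hr, rfl⟩ := h.cons_inv
    rcases hs with rfl | rfl
    · exact (hr.step (q := P) true).step (q := O) true
    · obtain ⟨r, k', hs, hr, rfl⟩ := hr.cons_inv
      obtain rfl : r = Y := by rcases hs with rfl | rfl <;> rfl
      exact ((hr.step (q := P1) false).step (q := P) true).step (q := O) true
  | true :: true :: w, k, h => by
    obtain ⟨r, k', hs, hr, rfl⟩ := h.cons_inv
    rcases hs with rfl | rfl
    · exact (hr.step (q := P) true).step (q := O) true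
    · obtain ⟨r, k', hs, hr, rfl⟩ := hr.cons_inv
      rcases hs with rfl | rfl
      · exact ((hr.step (q := P1) true).step (q := P) true).step (q := O) true
      -- After a single peg the automaton is in `P`, where `11` cannot be a block by itself. The cut
      -- `1|11` is therefore replaced by `11|1`, and the single peg is pushed on into the remaining
      -- string.
      · exact (hr.cons_true.step (q := O1) true).step (q := O) true

/-- How a string accepted from a state of the automaton for solvable strings, followed by a rest
that can be read from `O` at cost `k`, can be read. -/
def Readable (p : R) (w : List Bool) (k : ℕ) : Prop :=
  match p with
  | .empty => Run O w (k + 1)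
  | .r1 => Run O (true :: w) (k + 1) ∧ (Run X0 w k ∨ Run O w k)
  | .r10 => Run O w k ∨ Run Y w k
  | .r11 => Run X w k ∨ Run O w k
  | .r100 => Run O w k
  | .r101 => Run Y1 w k ∧ (Run U0 w k ∨ Run W0 w k)
  | .r111 => Run X1 w k
  | .r1010 => Run Z w k
  | .r1110 => Run V w k
  | .r1111 => Run W w k ∨ Run U w k
  | .r10101 => Run Z1 w k ∧ Run W0 w k
  | .r11101 => Run V1 w k
  | .r11111 => Run W1 w k
  | .r111111 => Run W w k
  | .sink => False

/-- One step of an induction backwards through a block. `R` merges prefixes that `Q` keeps apart, so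
a state of `R` may stand for a conjunction of runs of `Q`, from which each incoming letter selects
what it needs; disjunctions leave open which run the rest of the string permits. A bound `k + 1`
marks a block not yet paid for. -/
theorem readable_cons {p : R} {b : Bool} {w : List Bool} {k : ℕ} (h : Readable (p.next b) w k) :
    Readable p (b :: w) k := by
  cases p <;> cases b <;> simp only [R.next, Readable] at h ⊢
  case empty.false => exact h.step false
  case empty.true => exact h.1
  case r1.false =>
    rcases h with h | h
    · exact ⟨(h.step (q := P) false).step true, .inr (h.step false)⟩
    · exact ⟨(h.step (q := O1) false).step true, .inl (h.step false)⟩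
  case r1.true =>
    rcases h with h | h
    · exact ⟨(h.step (q := O1) true).step true, .inl (h.step true)⟩
    · exact ⟨(h.step (q := O1) true).step true, .inl (h.step true)⟩
  case r10.false => exact .inl (h.step false)
  case r10.true => exact .inr (h.1.step true)
  case r11.false =>
    rcases h.2 with h | h
    · exact .inl (h.step false)
    · exact .inr (h.step false)
  case r11.true => exact .inl (h.step true)
  case r100.false => exact h.step false
  case r101.false => exact ⟨h.step false, .inr (h.step false)⟩
  case r101.true =>
    rcases h with h | h
    · exact ⟨h.step true, .inr (h.step true)⟩
    · exact ⟨h.step true, .inl (h.step true)⟩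
  case r111.false => exact h.step false
  case r111.true => rcases h with h | h <;> exact h.step true
  case r1010.true => exact h.1.step true
  case r1110.true => exact h.step true
  case r1111.false =>
    rcases h.2 with h | h
    · exact .inr (h.step false)
    · exact .inl (h.step false)
  case r1111.true => exact .inl (h.step true)
  case r10101.false => exact ⟨h.step false, h.step false⟩
  case r10101.true => exact ⟨h.step true, h.step true⟩
  case r11101.true => exact h.step true
  case r11111.false => exact h.step false
  case r11111.true => exact h.step true
  case r111111.false => exact h.2.step false
  case r111111.true => exact h.step true

theorem readable_append {u w : List Bool} {k : ℕ} (hw : Run O w k) {p : R}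
    (hu : (p.run u).accepts = true) : Readable p (u ++ w) k := by
  induction u generalizing p with
  | nil =>
    cases p <;> cases hu
    · exact ⟨hw.cons_true, .inr hw⟩
    · exact .inl hw
    · exact .inr hw
    · exact hw
  | cons b u ih => exact readable_cons (ih hu)

theorem Run.of_splits {w : List Bool} {k : ℕ} (h : Splits w k) : Run O w k := by
  induction h with
  | @holes w h =>
    induction w with
    | nil => exact .nil_O
    | cons b w ih =>
      obtain rfl := h b (by simp)
      exact (ih fun b hb => h b (List.mem_cons_of_mem _ hb)).step false
  | cons hu _ ih => exact readable_append ih hu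

theorem Run.of_reducibleTo {w : List Bool} {k : ℕ} (h : ReducibleTo (ofString w) k) :
    Run O w k := by
  obtain ⟨ms, c, h, rfl⟩ := h
  exact .of_splits (.of_plays h (ofString_eq_cells w))

end Q
end PegSolitaire

namespace RAM

/-! ### Execution and running time of programs -/

instance (s : State) : (b : Test) → Decidable (b.Holds s)
  | .eq x y => inferInstanceAs (Decidable (s.reg x = s.reg y))
  | .lt x y => inferInstanceAs (Decidable (s.reg x < s.reg y))

namespace Prog

/-- The program contains no loop. -/
def LoopFree : Prog → Prop
  | seq p q => p.LoopFree ∧ q.LoopFree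
  | ite _ p q => p.LoopFree ∧ q.LoopFree
  | .while _ _ => False
  | _ => True

/-- The number of instructions and tests, which bounds the running time without loops. -/
def size : Prog → ℕ
  | seq p q => p.size + q.size
  | ite _ p q => p.size + q.size + 1
  | .while _ p => p.size + 1
  | _ => 1

/-- The state transformation of a program without loops. -/
def effect : Prog → State → State
  | skip, s => s
  | const x v, s => s.setReg x v
  | copy x y, s => s.setReg x (s.reg y)
  | incr x, s => s.setReg x (s.reg x + 1)
  | decr x, s => s.setReg x (s.reg x - 1)
  | load x A i, s => s.setReg x (s.arr A (s.reg i))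
  | store A i x, s => s.setArr A (s.reg i) (s.reg x)
  | emit x, s => { s with out := s.out ++ [s.reg x] }
  | seq p q, s => q.effect (p.effect s)
  | ite b p q, s => if b.Holds s then p.effect s else q.effect s
  | .while _ _, s => s

theorem LoopFree.exec {p : Prog} (h : p.LoopFree) (s : State) :
    ∃ t ≤ p.size, Exec p s (p.effect s) t := by
  induction p generalizing s with
  | skip => exact ⟨1, le_rfl, .skip s⟩
  | const x v => exact ⟨1, le_rfl, .const s x v⟩
  | copy x y => exact ⟨1, le_rfl, .copy s x y⟩
  | incr x => exact ⟨1, le_rfl, .incr s x⟩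
  | decr x => exact ⟨1, le_rfl, .decr s x⟩
  | load x A i => exact ⟨1, le_rfl, .load s x A i⟩
  | store A i x => exact ⟨1, le_rfl, .store s A i x⟩
  | emit x => exact ⟨1, le_rfl, .emit s x⟩
  | seq p q ihp ihq =>
    obtain ⟨t₁, h₁, e₁⟩ := ihp h.1 s
    obtain ⟨t₂, h₂, e₂⟩ := ihq h.2 (p.effect s)
    exact ⟨t₁ + t₂, Nat.add_le_add h₁ h₂, .seq e₁ e₂⟩
  | ite b p q ihp ihq =>
    by_cases hb : b.Holds s
    · obtain ⟨t, ht, e⟩ := ihp h.1 s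
      refine ⟨t + 1, by simp only [size]; omega, ?_⟩
      rw [effect, if_pos hb]
      exact .iteTrue hb e
    · obtain ⟨t, ht, e⟩ := ihq h.2 s
      refine ⟨t + 1, by simp only [size]; omega, ?_⟩
      rw [effect, if_neg hb]
      exact .iteFalse hb e
  | _ => exact h.elim

end Prog

/-- Started in `s`, the program `p` halts within `T` steps in a state that satisfies `Post`. -/
def Ends (p : Prog) (s : State) (T : ℕ) (Post : State → Prop) : Prop :=
  ∃ s' t, Exec p s s' t ∧ t ≤ T ∧ Post s'

theorem Prog.LoopFree.ends {p : Prog} (h : p.LoopFree) {s : State} {Post : State → Prop}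
    (hs : Post (p.effect s)) : Ends p s p.size Post := by
  obtain ⟨t, ht, e⟩ := h.exec s
  exact ⟨_, t, e, ht, hs⟩

theorem Ends.seq {p q : Prog} {s : State} {T T' : ℕ} {Mid Post : State → Prop}
    (hp : Ends p s T Mid) (hq : ∀ s', Mid s' → Ends q s' T' Post) :
    Ends (.seq p q) s (T + T') Post := by
  obtain ⟨s₁, t₁, e₁, h₁, hs₁⟩ := hp
  obtain ⟨s₂, t₂, e₂, h₂, hs₂⟩ := hq s₁ hs₁
  exact ⟨s₂, t₁ + t₂, e₁.seq e₂, Nat.add_le_add h₁ h₂, hs₂⟩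

/-- A loop with invariant `I`, indexed by the number of iterations still to come. -/
theorem Ends.while {b : Test} {p : Prog} (hp : p.LoopFree) (I : ℕ → State → Prop)
    (hstep : ∀ m s, I (m + 1) s → b.Holds s ∧ I m (p.effect s))
    (hend : ∀ s, I 0 s → ¬ b.Holds s) {m : ℕ} {s : State} (hs : I m s) :
    Ends (.while b p) s (m * (p.size + 1) + 1) (I 0) := by
  induction m generalizing s with
  | zero => exact ⟨s, 1, .whileFalse (hend s hs), by simp, hs⟩
  | succ m ih =>
    obtain ⟨hb, hs'⟩ := hstep m s hs
    obtain ⟨t, ht, e⟩ := hp.exec s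
    obtain ⟨s', t', e', ht', hI⟩ := ih hs'
    refine ⟨s', t + t' + 1, .whileTrue hb e e', ?_, hI⟩
    rw [Nat.succ_mul]
    omega

@[simp] theorem setReg_setReg (s : State) (x : ℕ) (u v : ℤ) :
    (s.setReg x u).setReg x v = s.setReg x v := by
  simp [State.setReg]

@[simp] theorem reg_setReg (s : State) (x y : ℕ) (v : ℤ) :
    (s.setReg x v).reg y = if y = x then v else s.reg y := by
  simp [State.setReg, Function.update_apply]

@[simp] theorem arr_setReg (s : State) (x : ℕ) (v : ℤ) : (s.setReg x v).arr = s.arr := rfl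

@[simp] theorem out_setReg (s : State) (x : ℕ) (v : ℤ) : (s.setReg x v).out = s.out := rfl

@[simp] theorem reg_setArr (s : State) (A : ℕ) (i v : ℤ) : (s.setArr A i v).reg = s.reg := rfl

@[simp] theorem out_setArr (s : State) (A : ℕ) (i v : ℤ) : (s.setArr A i v).out = s.out := rfl

@[simp] theorem arr_setArr (s : State) (A B : ℕ) (i j v : ℤ) :
    (s.setArr A i v).arr B j = if B = A ∧ j = i then v else s.arr B j := by
  by_cases h : B = A
  · subst h
    simp [State.setArr, Function.update_apply]
  · simp [State.setArr, h]

namespace Prog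

/-- Run `f a` for all members `a` of a list. -/
def seqAll {α : Type*} (l : List α) (f : α → Prog) : Prog :=
  l.foldr (fun a p => seq (f a) p) skip

theorem LoopFree.seqAll {α : Type*} {l : List α} {f : α → Prog} (h : ∀ a, (f a).LoopFree) :
    (seqAll l f).LoopFree := by
  induction l with
  | nil => trivial
  | cons a l ih => exact ⟨h a, ih⟩

/-- `x := x + k` for a constant `k`. -/
def addNat (x : ℕ) : ℕ → Prog
  | 0 => skip
  | k + 1 => seq (incr x) (addNat x k)

/-- `x := x - k` for a constant `k`. -/
def subNat (x : ℕ) : ℕ → Prog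
  | 0 => skip
  | k + 1 => seq (decr x) (subNat x k)

/-- `x := x + z` for a constant `z`. -/
def addInt (x : ℕ) : ℤ → Prog
  | .ofNat k => addNat x k
  | .negSucc k => subNat x (k + 1)

theorem loopFree_addNat (x k : ℕ) : (addNat x k).LoopFree := by
  induction k with
  | zero => trivial
  | succ k ih => exact ⟨trivial, ih⟩

theorem loopFree_subNat (x k : ℕ) : (subNat x k).LoopFree := by
  induction k with
  | zero => trivial
  | succ k ih => exact ⟨trivial, ih⟩

theorem loopFree_addInt (x : ℕ) (z : ℤ) : (addInt x z).LoopFree := by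
  cases z
  · exact loopFree_addNat _ _
  · exact loopFree_subNat _ _

theorem effect_addNat (x k : ℕ) (s : State) :
    (addNat x k).effect s = s.setReg x (s.reg x + k) := by
  induction k generalizing s with
  | zero => simp [addNat, effect, State.setReg]
  | succ k ih =>
    simp only [addNat, effect, ih, setReg_setReg, reg_setReg, if_true]
    push_cast
    ring_nf

theorem effect_subNat (x k : ℕ) (s : State) :
    (subNat x k).effect s = s.setReg x (s.reg x - k) := by
  induction k generalizing s with
  | zero => simp [subNat, effect, State.setReg]
  | succ k ih =>
    simp only [subNat, effect, ih, setReg_setReg, reg_setReg, if_true]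
    push_cast
    ring_nf

theorem effect_addInt (x : ℕ) (z : ℤ) (s : State) :
    (addInt x z).effect s = s.setReg x (s.reg x + z) := by
  cases z with
  | ofNat k => exact effect_addNat x k s
  | negSucc k =>
    rw [addInt, effect_subNat, Int.negSucc_eq]
    push_cast
    ring_nf

end Prog
end RAM

namespace PegSolitaire
open RAM Prog

namespace Q

/-! ### Automaton states in registers, and output of moves -/

/-- All states. -/
def all : List Q :=
  [O, P, O1, P1, X, X0, X1, Y, Y1, Z, Z1, W, W0, W1, V, V1, U, U0, D]

theorem mem_all (q : Q) : q ∈ all := by cases q <;> decide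

/-- The number of a state. -/
def code (q : Q) : ℕ := all.idxOf q

theorem code_inj {q r : Q} : q.code = r.code ↔ q = r :=
  List.idxOf_inj (mem_all q)

/-- The array of the costs from state `q`. -/
def costArr (q : Q) : ℕ := 2 * q.code + 2

/-- The array of the chosen successors of state `q`. -/
def nextArr (q : Q) : ℕ := 2 * q.code + 3

theorem costArr_inj {q r : Q} : q.costArr = r.costArr ↔ q = r := by
  rw [← code_inj, costArr, costArr]
  omega

theorem nextArr_inj {q r : Q} : q.nextArr = r.nextArr ↔ q = r := by
  rw [← code_inj, nextArr, nextArr]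
  omega

theorem costArr_ne_nextArr {q r : Q} : q.costArr ≠ r.nextArr := by
  rw [costArr, nextArr]
  omega

/-- Run `f q` for the member `q` of the list whose code is in register `x`; register `6` is
overwritten. -/
def switch (x : ℕ) (f : Q → Prog) (l : List Q) : Prog :=
  l.foldr (fun q p => .seq (.const 6 q.code) (.ite (.eq 6 x) (f q) p)) .skip

theorem loopFree_switch {x : ℕ} {f : Q → Prog} (h : ∀ q, (f q).LoopFree) (l : List Q) :
    (switch x f l).LoopFree := by
  induction l with
  | nil => trivial
  | cons q l ih => exact ⟨trivial, h q, ih⟩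

theorem effect_switch {x : ℕ} (hx : x ≠ 6) (f : Q → Prog) {l : List Q} {q : Q} (hq : q ∈ l)
    {s : State} (hs : s.reg x = q.code) :
    (switch x f l).effect s = (f q).effect (s.setReg 6 q.code) := by
  induction l generalizing s with
  | nil => cases hq
  | cons r l ih =>
    have e : (switch x f (r :: l)).effect s =
        if r = q then (f r).effect (s.setReg 6 r.code)
          else (switch x f l).effect (s.setReg 6 r.code) := by
      have : (Test.eq 6 x).Holds (s.setReg 6 r.code) ↔ r = q := by
        simp [Test.Holds, hx, hs, code_inj]
      simp only [switch, List.foldr_cons, effect, this]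
    rw [e]
    split_ifs with h
    · rw [h]
    · rw [ih ((List.mem_cons.1 hq).resolve_left (Ne.symm h)) (by simp [hx, hs]), setReg_setReg]

/-- Put the given moves, relative to register `1`, on the output tape. -/
def emitMoves (ms : List Move) : Prog :=
  seqAll ms fun m => .seq (.seq (.copy 5 1) (.seq (addInt 5 m.1) (.emit 5)))
    (.seq (.copy 5 1) (.seq (addInt 5 m.2) (.emit 5)))

theorem loopFree_emitMoves (ms : List Move) : (emitMoves ms).LoopFree :=
  .seqAll fun _ =>
    ⟨⟨trivial, loopFree_addInt _ _, trivial⟩, ⟨trivial, loopFree_addInt _ _, trivial⟩⟩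

theorem effect_emitMoves (ms : List Move) (s : State) :
    let s' := (emitMoves ms).effect s
    s'.arr = s.arr ∧ (∀ x, x ≠ 5 → s'.reg x = s.reg x) ∧
      s'.out = s.out ++ (ms.map (shift (s.reg 1))).flatMap fun m => [m.1, m.2] := by
  induction ms generalizing s with
  | nil => simp [emitMoves, seqAll, effect]
  | cons m ms ih =>
    obtain ⟨h₁, h₂, h₃⟩ := ih ((seqAll [m] fun m =>
      .seq (.seq (.copy 5 1) (.seq (addInt 5 m.1) (.emit 5)))
      (.seq (.copy 5 1) (.seq (addInt 5 m.2) (.emit 5)))).effect s)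
    refine ⟨h₁.trans ?_, fun x hx => (h₂ x hx).trans ?_, h₃.trans ?_⟩
    · simp [seqAll, effect, effect_addInt]
    · simp [seqAll, effect, effect_addInt, hx]
    · simp [seqAll, effect, effect_addInt, shift]

/-- Output the moves for the transition between the states in registers `7` and `8`. -/
def emitTransition (mv : Q → Q → List Move) : Prog :=
  switch 7 (fun q => switch 8 (fun r => emitMoves (mv q r)) all) all

theorem loopFree_emitTransition (mv : Q → Q → List Move) : (emitTransition mv).LoopFree :=
  loopFree_switch (fun _ => loopFree_switch (fun _ => loopFree_emitMoves _) _) _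

theorem effect_emitTransition (mv : Q → Q → List Move) {s : State} {q r : Q}
    (hq : s.reg 7 = q.code) (hr : s.reg 8 = r.code) :
    let s' := (emitTransition mv).effect s
    s'.arr = s.arr ∧ (∀ x, x ≠ 5 → x ≠ 6 → s'.reg x = s.reg x) ∧
      s'.out = s.out ++ ((mv q r).map (shift (s.reg 1))).flatMap fun m => [m.1, m.2] := by
  have e : (emitTransition mv).effect s =
      (emitMoves (mv q r)).effect (s.setReg 6 r.code) := by
    rw [emitTransition, effect_switch (by decide) _ (mem_all q) hq,
      effect_switch (by decide) _ (mem_all r) (by simp [hr]), setReg_setReg]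
  obtain ⟨h₁, h₂, h₃⟩ := effect_emitMoves (mv q r) (s.setReg 6 r.code)
  rw [e]
  refine ⟨h₁, fun x h5 h6 => (h₂ x h5).trans (by simp [h6]), h₃.trans (by simp)⟩

end Q
end PegSolitaire

namespace PegSolitaire
open RAM Prog

namespace Q

/-! ### Cheapest paths by dynamic programming -/

instance (q : Q) : Decidable (Final q) := inferInstanceAs (Decidable (_ ∨ _))

/-- The least cost of reading a string from a state, where ending outside the accepting states
costs `B`. -/
def best (B : ℕ) : Q → List Bool → ℕ
  | q, [] => if Final q then 0 else B
  | q, b :: w => min (best B (q.next b).1 w) (best B (q.next b).2 w) + q.cost b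

/-- The first step of a cheapest way to read a string. -/
def choice (B : ℕ) (q : Q) : List Bool → Q
  | [] => q
  | b :: w => if best B (q.next b).2 w < best B (q.next b).1 w then (q.next b).2 else (q.next b).1

/-- The states met on a cheapest way to read a string. -/
def trace (B : ℕ) : Q → List Bool → List Q
  | _, [] => []
  | q, b :: w => choice B q (b :: w) :: trace B (choice B q (b :: w)) w

theorem step_choice (B : ℕ) (q : Q) (b : Bool) (w : List Bool) :
    Step q b (choice B q (b :: w)) := by
  rw [choice]
  split_ifs
  · exact .inr rfl
  · exact .inl rfl

theorem best_cons (B : ℕ) (q : Q) (b : Bool) (w : List Bool) :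
    best B q (b :: w) = q.cost b + best B (choice B q (b :: w)) w := by
  rw [best, choice, add_comm]
  split_ifs with h
  · rw [min_eq_right h.le]
  · rw [min_eq_left (not_lt.1 h)]

theorem Path.best_le {q : Q} {w : List Bool} {rs : List Q} {k : ℕ} (h : Path q w rs k) (B : ℕ) :
    best B q w ≤ k := by
  induction h with
  | nil h => simp [best, h]
  | cons hs _ ih =>
    rw [best, add_comm]
    refine Nat.add_le_add_left (le_trans ?_ ih) _
    rcases hs with rfl | rfl
    · exact min_le_left _ _
    · exact min_le_right _ _

/-- A total below `B` cannot include the penalty `B`, so the path of choices ends in an accepting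
state. -/
theorem path_trace {B : ℕ} {q : Q} {w : List Bool} (h : best B q w < B) :
    Path q w (trace B q w) (best B q w) := by
  induction w generalizing q with
  | nil =>
    by_cases hq : Final q
    · rw [best, if_pos hq]
      exact .nil hq
    · rw [best, if_neg hq] at h
      exact absurd h (lt_irrefl B)
  | cons b w ih =>
    rw [best_cons] at h ⊢
    exact .cons (step_choice B q b w) (ih (by omega))

/-- The state before cell `p` on a cheapest way to read `w`. -/
def stateAt (B : ℕ) (w : List Bool) : ℕ → Q
  | 0 => O
  | p + 1 => choice B (stateAt B w p) (w.drop p)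

/-- Links the recursion of `trace` along the string with the states indexed by cell, as the machine
stores them. -/
theorem trace_stateAt (B : ℕ) {w : List Bool} {p : ℕ} (hp : p < w.length) :
    trace B (stateAt B w p) (w.drop p) =
      stateAt B w (p + 1) :: trace B (stateAt B w (p + 1)) (w.drop (p + 1)) := by
  rw [stateAt, List.drop_eq_getElem_cons hp, trace]

/-! ### The program -/

/-- One step of the computation of costs, for the state `q` before the cell `b` in register `1`. -/
def costBranch (q : Q) (b : Bool) : Prog :=
  .seq (.load 5 (q.next b).1.costArr 2) <|
  .seq (.load 6 (q.next b).2.costArr 2) <|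
  .seq (.const 7 (q.next b).1.code) <|
  .seq (.ite (.lt 6 5) (.seq (.copy 5 6) (.const 7 (q.next b).2.code)) .skip) <|
  .seq (addNat 5 (q.cost b)) <|
  .seq (.store q.costArr 1 5) (.store q.nextArr 1 7)

/-- Register conventions: `0` holds the length, `1` the current cell, `2` its right neighbour, `3`
the constant zero, `4` the symbol read; `5` and `6` are scratch, `7` and `8` hold codes of states.
The test thus asks whether the symbol is a peg. -/
def costStep (q : Q) : Prog := .ite (.lt 3 4) (costBranch q true) (costBranch q false)

theorem loopFree_costStep (q : Q) : (costStep q).LoopFree :=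
  ⟨⟨trivial, trivial, trivial, ⟨⟨trivial, trivial⟩, trivial⟩, loopFree_addNat _ _, trivial, trivial⟩,
    ⟨trivial, trivial, trivial, ⟨⟨trivial, trivial⟩, trivial⟩, loopFree_addNat _ _, trivial,
      trivial⟩⟩

theorem two_le_costArr (q : Q) : 2 ≤ q.costArr := by
  rw [costArr]
  omega

theorem two_le_nextArr (q : Q) : 2 ≤ q.nextArr := by
  rw [nextArr]
  omega

theorem effect_costStep (B : ℕ) (q : Q) {b : Bool} {w : List Bool} {s : State}
    (h3 : s.reg 3 = 0) (h4 : s.reg 4 = if b then 1 else 0)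
    (hrow : ∀ r : Q, s.arr r.costArr (s.reg 2) = best B r w) :
    let s' := (costStep q).effect s
    s'.out = s.out ∧ (∀ x < 5, s'.reg x = s.reg x) ∧
      (∀ A i, A < 2 ∨ i ≠ s.reg 1 → s'.arr A i = s.arr A i) ∧
      (∀ r : Q, r = q ∨ s.arr r.costArr (s.reg 1) = best B r (b :: w) →
        s'.arr r.costArr (s.reg 1) = best B r (b :: w)) ∧
      (∀ r : Q, r = q ∨ s.arr r.nextArr (s.reg 1) = (choice B r (b :: w)).code →
        s'.arr r.nextArr (s.reg 1) = (choice B r (b :: w)).code) := by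
  have e : (costStep q).effect s = (costBranch q b).effect s := by
    cases b <;> simp [costStep, effect, Test.Holds, h3, h4]
  have e' : (costBranch q b).effect s =
      ((((s.setReg 5 (best B q (b :: w))).setReg 6 (best B (q.next b).2 w)).setReg 7
        (choice B q (b :: w)).code).setArr q.costArr (s.reg 1) (best B q (b :: w))).setArr q.nextArr
          (s.reg 1) (choice B q (b :: w)).code := by
    have h : ∀ u v : State, u.reg = v.reg → u.arr = v.arr → u.out = v.out → u = v := by
      rintro ⟨_, _, _⟩ ⟨_, _, _⟩ rfl rfl rfl
      rfl
    have hb := best_cons B q b w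
    by_cases hlt : best B (q.next b).2 w < best B (q.next b).1 w
    · have hc : choice B q (b :: w) = (q.next b).2 := if_pos hlt
      rw [hc] at hb ⊢
      rw [hb]
      apply h
      · funext x
        simp [costBranch, effect, effect_addNat, Test.Holds, hrow, hlt]
        grind
      · funext A i
        simp [costBranch, effect, effect_addNat, Test.Holds, hrow, hlt, add_comm]
      · simp [costBranch, effect, effect_addNat, Test.Holds, hrow, hlt]
    · have hc : choice B q (b :: w) = (q.next b).1 := if_neg hlt
      rw [hc] at hb ⊢
      rw [hb]
      apply h
      · funext x
        simp [costBranch, effect, effect_addNat, Test.Holds, hrow, hlt]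
        grind
      · funext A i
        simp [costBranch, effect, effect_addNat, Test.Holds, hrow, hlt, add_comm]
      · simp [costBranch, effect, effect_addNat, Test.Holds, hrow, hlt]
  rw [e, e']
  refine ⟨rfl, fun x hx => ?_, fun A i hA => ?_, fun r hr => ?_, fun r hr => ?_⟩
  · simp only [reg_setArr, reg_setReg]
    rw [if_neg (by omega), if_neg (by omega), if_neg (by omega)]
  · simp only [arr_setArr, arr_setReg]
    have := q.two_le_costArr
    have := q.two_le_nextArr
    rw [if_neg (by omega), if_neg (by omega)]
  · simp only [arr_setArr, arr_setReg, costArr_ne_nextArr, if_false, costArr_inj,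
      and_true]
    split_ifs with h
    · rw [h]
    · exact hr.resolve_left h
  · simp only [arr_setArr, arr_setReg, costArr_ne_nextArr.symm, if_false, nextArr_inj,
      and_true]
    split_ifs with h
    · rw [h]
    · exact hr.resolve_left h

/-- Costs are read at the right neighbour and written at the current cell, so treating one state
does not disturb the data for the others. The alternative "already correct" in the last two clauses
carries the induction over `l`. -/
theorem effect_seqAll_costStep (B : ℕ) {b : Bool} {w : List Bool} (l : List Q) {s : State}
    (hne : s.reg 2 ≠ s.reg 1) (h3 : s.reg 3 = 0) (h4 : s.reg 4 = if b then 1 else 0)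
    (hrow : ∀ r : Q, s.arr r.costArr (s.reg 2) = best B r w) :
    let s' := (seqAll l costStep).effect s
    s'.out = s.out ∧ (∀ x < 5, s'.reg x = s.reg x) ∧
      (∀ A i, A < 2 ∨ i ≠ s.reg 1 → s'.arr A i = s.arr A i) ∧
      (∀ r : Q, r ∈ l ∨ s.arr r.costArr (s.reg 1) = best B r (b :: w) →
        s'.arr r.costArr (s.reg 1) = best B r (b :: w)) ∧
      (∀ r : Q, r ∈ l ∨ s.arr r.nextArr (s.reg 1) = (choice B r (b :: w)).code →
        s'.arr r.nextArr (s.reg 1) = (choice B r (b :: w)).code) := by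
  induction l generalizing s with
  | nil => simp [seqAll, effect]
  | cons q l ih =>
    obtain ⟨h₁, h₂, h₃, h₄, h₅⟩ := effect_costStep B q h3 h4 hrow
    obtain ⟨g₁, g₂, g₃, g₄, g₅⟩ := ih (s := (costStep q).effect s)
      (by rwa [h₂ 2 (by decide), h₂ 1 (by decide)]) (by rwa [h₂ 3 (by decide)])
      (by rwa [h₂ 4 (by decide)])
      (fun r => by rw [h₂ 2 (by decide), h₃ _ _ (.inr hne), hrow])
    rw [h₂ 1 (by decide)] at g₃ g₄ g₅
    refine ⟨g₁.trans h₁, fun x hx => (g₂ x hx).trans (h₂ x hx),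
      fun A i hA => (g₃ A i hA).trans (h₃ A i hA), fun r hr => g₄ r ?_, fun r hr => g₅ r ?_⟩
    · rcases hr with hr | hr
      · rcases List.mem_cons.1 hr with rfl | hr
        · exact .inr (h₄ r (.inl rfl))
        · exact .inl hr
      · exact .inr (h₄ r (.inr hr))
    · rcases hr with hr | hr
      · rcases List.mem_cons.1 hr with rfl | hr
        · exact .inr (h₅ r (.inl rfl))
        · exact .inl hr
      · exact .inr (h₅ r (.inr hr))

/-- Set the costs at the end of the string. -/
def finalCost (q : Q) : Prog :=
  if Final q then .store q.costArr 1 3 else .store q.costArr 1 5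

theorem loopFree_finalCost (q : Q) : (finalCost q).LoopFree := by
  unfold finalCost
  split_ifs <;> trivial

theorem effect_finalCost {B : ℕ} (q : Q) {s : State} (h3 : s.reg 3 = 0) (h5 : s.reg 5 = B) :
    (finalCost q).effect s = s.setArr q.costArr (s.reg 1) (best B q []) := by
  unfold finalCost best
  split_ifs <;> simp [effect, h3, h5]

theorem effect_seqAll_finalCost (B : ℕ) (l : List Q) {s : State} (h3 : s.reg 3 = 0)
    (h5 : s.reg 5 = B) :
    let s' := (seqAll l finalCost).effect s
    s'.out = s.out ∧ s'.reg = s.reg ∧ s'.arr 0 = s.arr 0 ∧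
      (∀ r : Q, r ∈ l ∨ s.arr r.costArr (s.reg 1) = best B r [] →
        s'.arr r.costArr (s.reg 1) = best B r []) := by
  induction l generalizing s with
  | nil => simp [seqAll, effect]
  | cons q l ih =>
    have e := effect_finalCost (B := B) q h3 h5
    obtain ⟨g₁, g₂, g₃, g₄⟩ := ih (s := (finalCost q).effect s) (by rwa [e]) (by rwa [e])
    rw [e] at g₁ g₂ g₃ g₄
    simp only [seqAll, List.foldr_cons, effect, e]
    refine ⟨g₁, g₂, g₃.trans ?_, fun r hr => g₄ r ?_⟩
    · funext i
      have := q.two_le_costArr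
      rw [arr_setArr, if_neg (by omega)]
    · simp only [arr_setArr, reg_setArr, costArr_inj, and_true]
      by_cases h : r = q
      · exact .inr (by rw [if_pos h, h])
      · rw [if_neg h]
        exact hr.imp_left fun hr => (List.mem_cons.1 hr).resolve_left h

/-- Prepare the computation of the costs. -/
def costInit : Prog :=
  .seq (.copy 1 0) <| .seq (.copy 5 0) <| .seq (.incr 5) (seqAll all finalCost)

/-- Go one cell to the left and compute the costs there. -/
def costBody : Prog :=
  .seq (.copy 2 1) <| .seq (.decr 1) <| .seq (.load 4 0 1) (seqAll all costStep)

/-- Output the least cost and start the search for a cheapest way. -/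
def traceInit : Prog :=
  .seq (.load 5 O.costArr 1) <| .seq (.emit 5) <| .seq (.const 7 O.code) (.store 1 1 7)

/-- Go one cell to the right and record the state there. -/
def traceBody : Prog :=
  .seq (switch 7 (fun q => .load 8 q.nextArr 1) all) <|
  .seq (.copy 7 8) <| .seq (.incr 1) (.store 1 1 7)

/-- Fetch the states around a cell. -/
def fetch : Prog := .seq (.load 7 1 1) <| .seq (.copy 2 1) <| .seq (.incr 2) (.load 8 1 2)

/-- The moves are written relative to the cell treated, and register `1` starts one past it; hence
the decrement comes first here, whereas `rightBody` increments last. -/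
def leftBody : Prog := .seq (.decr 1) <| .seq fetch (emitTransition leftMoves)

def rightBody : Prog := .seq fetch <| .seq (emitTransition rightMoves) (.incr 1)

/-- The whole program. -/
def solver : Prog :=
  .seq costInit <| .seq (.while (.lt 3 1) costBody) <|
  .seq traceInit <| .seq (.while (.lt 1 0) traceBody) <|
  .seq (.while (.lt 3 1) leftBody) (.while (.lt 1 0) rightBody)

theorem loopFree_costInit : costInit.LoopFree :=
  ⟨trivial, trivial, trivial, .seqAll loopFree_finalCost⟩

theorem loopFree_costBody : costBody.LoopFree :=
  ⟨trivial, trivial, trivial, .seqAll loopFree_costStep⟩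

theorem loopFree_traceBody : traceBody.LoopFree :=
  ⟨loopFree_switch (f := fun q => .load 8 q.nextArr 1) (fun _ => trivial) _, trivial, trivial,
    trivial⟩

theorem loopFree_fetch : fetch.LoopFree := ⟨trivial, trivial, trivial, trivial⟩

theorem loopFree_leftBody : leftBody.LoopFree :=
  ⟨trivial, loopFree_fetch, loopFree_emitTransition _⟩

theorem loopFree_rightBody : rightBody.LoopFree :=
  ⟨loopFree_fetch, loopFree_emitTransition _, trivial⟩

/-! ### Loop invariants and linear running time -/

section Correctness

variable (w : List Bool)

/-- The costs and choices are known from cell `m` on. -/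
structure CostInv (m : ℕ) (s : State) : Prop where
  le : m ≤ w.length
  reg0 : s.reg 0 = w.length
  reg1 : s.reg 1 = m
  reg3 : s.reg 3 = 0
  out : s.out = []
  input : s.arr 0 = (init w).arr 0
  cost : ∀ (q : Q) (p : ℕ), m ≤ p → p ≤ w.length →
    s.arr q.costArr p = best (w.length + 1) q (w.drop p)
  next : ∀ (q : Q) (p : ℕ), m ≤ p → p < w.length →
    s.arr q.nextArr p = (choice (w.length + 1) q (w.drop p)).code

theorem costInv_costInit : CostInv w w.length (costInit.effect (init w)) := by
  obtain ⟨h₁, h₂, h₃, h₄⟩ := effect_seqAll_finalCost (w.length + 1) all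
    (s := (((init w).setReg 1 w.length).setReg 5 w.length).setReg 5 (w.length + 1))
    (by simp [init]) (by simp)
  have e : costInit.effect (init w) = (seqAll all finalCost).effect
      ((((init w).setReg 1 w.length).setReg 5 w.length).setReg 5 (w.length + 1)) := by
    simp [costInit, effect, init]
  rw [e]
  refine ⟨le_rfl, ?_, ?_, ?_, h₁, h₃, fun q p hp hp' => ?_, fun q p hp hp' => by omega⟩
  · rw [h₂]; simp [init]
  · rw [h₂]; simp [init]
  · rw [h₂]; simp [init]
  · obtain rfl : p = w.length := by omega
    simpa using h₄ q (.inl (mem_all q))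

variable {w}

theorem CostInv.step {m : ℕ} {s : State} (h : CostInv w (m + 1) s) :
    CostInv w m (costBody.effect s) := by
  have hlt : m < w.length := h.le
  have hin : s.arr 0 (s.reg 1 - 1) = if w[m] then 1 else 0 := by
    have : (s.reg 1 - 1) = (m : ℤ) := by rw [h.reg1]; push_cast; ring
    rw [this, h.input]
    simp [init, hlt]
  have e : costBody.effect s = (seqAll all costStep).effect
      (((s.setReg 2 (s.reg 1)).setReg 1 (m : ℤ)).setReg 4 (if w[m] then 1 else 0)) := by
    have : (s.reg 1 - 1) = (m : ℤ) := by rw [h.reg1]; push_cast; ring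
    rw [this] at hin
    simp [costBody, effect, this, hin]
  obtain ⟨h₁, h₂, h₃, h₄, h₅⟩ := effect_seqAll_costStep (w.length + 1) (b := w[m])
    (w := w.drop (m + 1)) all
    (s := ((s.setReg 2 (s.reg 1)).setReg 1 (m : ℤ)).setReg 4 (if w[m] then 1 else 0))
    (by simp [h.reg1]) (by simp [h.reg3]) (by simp)
    (fun r => by simpa [h.reg1] using h.cost r (m + 1) le_rfl h.le)
  have hdrop := List.drop_eq_getElem_cons hlt
  simp only [reg_setReg, arr_setReg] at h₃ h₄ h₅
  rw [e]
  refine ⟨hlt.le, ?_, ?_, ?_, ?_, ?_, fun q p hp hp' => ?_, fun q p hp hp' => ?_⟩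
  · rw [h₂ 0 (by decide)]; simpa using h.reg0
  · rw [h₂ 1 (by decide)]; simp
  · rw [h₂ 3 (by decide)]; simpa using h.reg3
  · rw [h₁]; exact h.out
  · funext i
    rw [h₃ 0 i (.inl (by decide)), h.input]
  · rcases hp.eq_or_lt with rfl | hp
    · rw [hdrop]
      exact h₄ q (.inl (mem_all q))
    · rw [h₃ _ _ (.inr (by simp; omega))]
      exact h.cost q p hp hp'
  · rcases hp.eq_or_lt with rfl | hp
    · rw [hdrop]
      exact h₅ q (.inl (mem_all q))
    · rw [h₃ _ _ (.inr (by simp; omega))]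
      exact h.next q p hp hp'

variable (w) in
/-- The number of pegs that the program announces. -/
def optimum : ℕ := best (w.length + 1) O w

variable (w) in
/-- The states on the chosen way are known up to the cell that is `m` cells before the end. -/
structure TraceInv (m : ℕ) (s : State) : Prop where
  le : m ≤ w.length
  reg0 : s.reg 0 = w.length
  reg1 : s.reg 1 = w.length - m
  reg3 : s.reg 3 = 0
  reg7 : s.reg 7 = (stateAt (w.length + 1) w (w.length - m)).code
  out : s.out = [(optimum w : ℤ)]
  next : ∀ (q : Q) (p : ℕ), p < w.length →
    s.arr q.nextArr p = (choice (w.length + 1) q (w.drop p)).code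
  label : ∀ p : ℕ, p + m ≤ w.length → s.arr 1 p = (stateAt (w.length + 1) w p).code

theorem CostInv.traceInv {s : State} (h : CostInv w 0 s) :
    TraceInv w w.length (traceInit.effect s) := by
  have h1 := h.reg1
  refine ⟨le_rfl, ?_, ?_, ?_, ?_, ?_, fun q p hp => ?_, fun p hp => ?_⟩
  · simpa [traceInit, effect] using h.reg0
  · simp [traceInit, effect, h.reg1]
  · simpa [traceInit, effect] using h.reg3
  · simp [traceInit, effect, stateAt]
  · have := h.cost O 0 le_rfl (Nat.zero_le _)
    simp [traceInit, effect, h.out, h.reg1, optimum] at this ⊢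
    exact this
  · have := q.two_le_nextArr
    have h' : q.nextArr ≠ 1 := by omega
    simpa [traceInit, effect, h'] using h.next q p (Nat.zero_le _) hp
  · obtain rfl : p = 0 := by omega
    simp [traceInit, effect, h.reg1, stateAt]

theorem TraceInv.step {m : ℕ} {s : State} (h : TraceInv w (m + 1) s) :
    TraceInv w m (traceBody.effect s) := by
  have hle := h.le
  obtain ⟨p, hp⟩ : ∃ p, p + (m + 1) = w.length := ⟨w.length - (m + 1), by omega⟩
  have hp₀ : w.length - (m + 1) = p := by omega
  have hp₁ : w.length - m = p + 1 := by omega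
  have h1 : s.reg 1 = p := by
    rw [h.reg1]
    push_cast
    omega
  have h7 := h.reg7
  rw [hp₀] at h7
  have hc : s.arr (nextArr (stateAt (w.length + 1) w p)) p =
      (stateAt (w.length + 1) w (p + 1)).code := h.next _ p (by omega)
  have e : traceBody.effect s = ((((((s.setReg 6 (stateAt (w.length + 1) w p).code).setReg 8
      (stateAt (w.length + 1) w (p + 1)).code).setReg 7
      (stateAt (w.length + 1) w (p + 1)).code).setReg 1 (p + 1)).setArr 1 (p + 1)
      (stateAt (w.length + 1) w (p + 1)).code)) := by
    simp [traceBody, effect, effect_switch (x := 7) (by decide) _ (mem_all _) h7, h1, hc]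
  rw [e]
  refine ⟨by omega, ?_, ?_, ?_, ?_, ?_, fun q i hi => ?_, fun i hi => ?_⟩
  · simpa using h.reg0
  · simp only [reg_setArr, reg_setReg, if_true]
    omega
  · simpa using h.reg3
  · simp [hp₁]
  · exact h.out
  · have := q.two_le_nextArr
    rw [arr_setArr, if_neg (by omega)]
    exact h.next q i hi
  · rw [arr_setArr]
    by_cases hip : i = p + 1
    · subst hip
      rw [if_pos ⟨rfl, by push_cast; rfl⟩]
    · rw [if_neg (by omega)]
      exact h.label i (by omega)

variable (w) in
/-- The moves of the sweep to the left from cell `p` on. -/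
def leftFrom (p : ℕ) : List Move :=
  leftSweep p (stateAt (w.length + 1) w p)
    (trace (w.length + 1) (stateAt (w.length + 1) w p) (w.drop p))

variable (w) in
/-- The moves of the sweep to the right from cell `p` on. -/
def rightFrom (p : ℕ) : List Move :=
  rightSweep p (stateAt (w.length + 1) w p)
    (trace (w.length + 1) (stateAt (w.length + 1) w p) (w.drop p))

theorem leftFrom_eq {p : ℕ} (hp : p < w.length) :
    leftFrom w p = leftFrom w (p + 1) ++ (leftMoves (stateAt (w.length + 1) w p)
      (stateAt (w.length + 1) w (p + 1))).map (shift p) := by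
  rw [leftFrom, trace_stateAt _ hp, leftSweep, leftFrom]
  push_cast
  rfl

theorem rightFrom_eq {p : ℕ} (hp : p < w.length) :
    rightFrom w p = (rightMoves (stateAt (w.length + 1) w p)
      (stateAt (w.length + 1) w (p + 1))).map (shift p) ++ rightFrom w (p + 1) := by
  rw [rightFrom, trace_stateAt _ hp, rightSweep, rightFrom]
  push_cast
  rfl

theorem leftFrom_length : leftFrom w w.length = [] := by
  rw [leftFrom, List.drop_length, trace, leftSweep]

theorem rightFrom_length : rightFrom w w.length = [] := by
  rw [rightFrom, List.drop_length, trace, rightSweep]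

theorem encodeOutput_append (k : ℕ) (ms ms' : List Move) :
    encodeOutput k (ms ++ ms') = encodeOutput k ms ++ ms'.flatMap fun m => [m.1, m.2] := by
  simp [encodeOutput]

theorem effect_fetch {s : State} {p : ℕ} {q r : Q} (h1 : s.reg 1 = p)
    (hq : s.arr 1 p = q.code) (hr : s.arr 1 ((p + 1 : ℕ) : ℤ) = r.code) :
    fetch.effect s = ((s.setReg 7 q.code).setReg 2 (p + 1)).setReg 8 r.code := by
  push_cast at hr
  simp [fetch, effect, h1, hq, hr]

variable (w) in
/-- The sweep to the left has been output from cell `m` on. -/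
structure LeftInv (m : ℕ) (s : State) : Prop where
  le : m ≤ w.length
  reg0 : s.reg 0 = w.length
  reg1 : s.reg 1 = m
  reg3 : s.reg 3 = 0
  label : ∀ p : ℕ, p ≤ w.length → s.arr 1 p = (stateAt (w.length + 1) w p).code
  out : s.out = encodeOutput (optimum w) (leftFrom w m)

theorem TraceInv.leftInv {s : State} (h : TraceInv w 0 s) : LeftInv w w.length s :=
  ⟨le_rfl, h.reg0, by simpa using h.reg1, h.reg3, h.label, by
    rw [h.out, leftFrom_length]
    rfl⟩

theorem LeftInv.step {m : ℕ} {s : State} (h : LeftInv w (m + 1) s) :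
    LeftInv w m (leftBody.effect s) := by
  have hlt : m < w.length := h.le
  have h1 : s.reg 1 - 1 = m := by
    rw [h.reg1]
    push_cast
    ring
  have ef := effect_fetch (s := s.setReg 1 m) (p := m) (by simp) (h.label m hlt.le)
    (h.label (m + 1) hlt)
  obtain ⟨h₁, h₂, h₃⟩ := effect_emitTransition leftMoves (s := fetch.effect (s.setReg 1 m))
    (q := stateAt (w.length + 1) w m)
    (by rw [ef]; simp) (by rw [ef, reg_setReg, if_pos rfl])
  have e : leftBody.effect s =
      (emitTransition leftMoves).effect (fetch.effect (s.setReg 1 m)) := by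
    simp only [leftBody, effect, h1]
  rw [e]
  refine ⟨hlt.le, ?_, ?_, ?_, ?_, ?_⟩
  · rw [h₂ 0 (by decide) (by decide), ef]; simpa using h.reg0
  · rw [h₂ 1 (by decide) (by decide), ef]; simp
  · rw [h₂ 3 (by decide) (by decide), ef]; simpa using h.reg3
  · rw [h₁, ef]; exact h.label
  · rw [h₃, ef, leftFrom_eq hlt, encodeOutput_append]
    simp [h.out]

variable (w) in
/-- The sweep to the right has been output except for the last `m` cells. -/
structure RightInv (m : ℕ) (s : State) : Prop where
  le : m ≤ w.length
  reg0 : s.reg 0 = w.length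
  reg1 : s.reg 1 = w.length - m
  label : ∀ p : ℕ, p ≤ w.length → s.arr 1 p = (stateAt (w.length + 1) w p).code
  -- The moves already written are characterised through those still to come, which makes up the
  -- full list.
  out : ∃ ms, s.out = encodeOutput (optimum w) ms ∧
    ms ++ rightFrom w (w.length - m) = leftFrom w 0 ++ rightFrom w 0

theorem LeftInv.rightInv {s : State} (h : LeftInv w 0 s) : RightInv w w.length s :=
  ⟨le_rfl, h.reg0, by simpa using h.reg1, h.label, _, h.out, by rw [Nat.sub_self]⟩

theorem RightInv.step {m : ℕ} {s : State} (h : RightInv w (m + 1) s) :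
    RightInv w m (rightBody.effect s) := by
  have hle := h.le
  obtain ⟨p, hp⟩ : ∃ p, p + (m + 1) = w.length := ⟨w.length - (m + 1), by omega⟩
  have hp₀ : w.length - (m + 1) = p := by omega
  have hp₁ : w.length - m = p + 1 := by omega
  have hlt : p < w.length := by omega
  have h1 : s.reg 1 = p := by
    rw [h.reg1]
    push_cast
    omega
  obtain ⟨ms, ho, hms⟩ := h.out
  have ef := effect_fetch h1 (h.label p hlt.le) (h.label (p + 1) hlt)
  obtain ⟨h₁, h₂, h₃⟩ := effect_emitTransition rightMoves (s := fetch.effect s)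
    (q := stateAt (w.length + 1) w p)
    (by rw [ef]; simp) (by rw [ef, reg_setReg, if_pos rfl])
  have e : rightBody.effect s = ((emitTransition rightMoves).effect (fetch.effect s)).setReg 1
      (((emitTransition rightMoves).effect (fetch.effect s)).reg 1 + 1) := rfl
  rw [e]
  refine ⟨by omega, ?_, ?_, ?_, ms ++ (rightMoves (stateAt (w.length + 1) w p)
    (stateAt (w.length + 1) w (p + 1))).map (shift p), ?_, ?_⟩
  · rw [reg_setReg, if_neg (by decide), h₂ 0 (by decide) (by decide), ef]; simpa using h.reg0
  · rw [reg_setReg, if_pos rfl, h₂ 1 (by decide) (by decide), ef]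
    simp [h1]
    omega
  · rw [arr_setReg, h₁, ef]; exact h.label
  · rw [out_setReg, h₃, ef]
    rw [encodeOutput_append]
    simp [ho, h1]
  · rw [hp₀, rightFrom_eq hlt, ← List.append_assoc] at hms
    rw [hp₁, hms]

theorem RightInv.out_eq {s : State} (h : RightInv w 0 s) :
    s.out = encodeOutput (optimum w) (leftFrom w 0 ++ rightFrom w 0) := by
  obtain ⟨ms, ho, hms⟩ := h.out
  rw [Nat.sub_zero, rightFrom_length, List.append_nil] at hms
  rw [ho, hms]

/-- Four loops run `w.length` times each, and their loop-free bodies have sizes that do not depend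
on `w`. -/
theorem ends_solver : ∃ C : ℕ, ∀ w : List Bool, Ends solver (init w) (C * (w.length + 1))
    fun s => s.out = encodeOutput (optimum w) (leftFrom w 0 ++ rightFrom w 0) := by
  refine ⟨costInit.size + traceInit.size + (costBody.size + 2) + (traceBody.size + 2) +
    (leftBody.size + 2) + (rightBody.size + 2), fun w => ?_⟩
  have key := (loopFree_costInit.ends (s := init w) (Post := CostInv w w.length)
      (costInv_costInit w)).seq fun s hs =>
    (Ends.while loopFree_costBody (CostInv w) (b := .lt 3 1)
      (fun m s h => ⟨by simp only [Test.Holds, h.reg1, h.reg3]; positivity, h.step⟩)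
      (fun s h => by simp [Test.Holds, h.reg1, h.reg3]) hs).seq fun s hs =>
    (LoopFree.ends (p := traceInit) ⟨trivial, trivial, trivial, trivial⟩
      (Post := TraceInv w w.length) hs.traceInv).seq fun s hs =>
    (Ends.while loopFree_traceBody (TraceInv w) (b := .lt 1 0)
      (fun m s h => ⟨by simp only [Test.Holds, h.reg1, h.reg0]; push_cast; omega, h.step⟩)
      (fun s h => by simp [Test.Holds, h.reg1, h.reg0]) hs).seq fun s hs =>
    (Ends.while loopFree_leftBody (LeftInv w) (b := .lt 3 1)
      (fun m s h => ⟨by simp only [Test.Holds, h.reg1, h.reg3]; positivity, h.step⟩)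
      (fun s h => by simp [Test.Holds, h.reg1, h.reg3]) hs.leftInv).seq fun s hs =>
    Ends.while loopFree_rightBody (RightInv w) (b := .lt 1 0)
      (fun m s h => ⟨by simp only [Test.Holds, h.reg1, h.reg0]; push_cast; omega, h.step⟩)
      (fun s h => by simp [Test.Holds, h.reg1, h.reg0]) hs.rightInv
  obtain ⟨s, t, e, ht, hs⟩ := key
  refine ⟨s, t, e, ht.trans ?_, hs.out_eq⟩
  generalize w.length = n, costInit.size = a, traceInit.size = b, costBody.size = c,
    traceBody.size = d, leftBody.size = f, rightBody.size = g
  nlinarith [Nat.zero_le (a * n), Nat.zero_le (b * n)]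

end Correctness

/-- The traced path supplies the play; any other play yields a path whose cost is the number of pegs
it leaves, and `best` is at most that cost. -/
theorem isLeast_optimum (w : List Bool) :
    IsLeast {j : ℕ | ReducibleTo (ofString w) j} (optimum w) ∧
      ∃ c, Plays (ofString w) (leftFrom w 0 ++ rightFrom w 0) c ∧ c.card = optimum w := by
  -- Making every peg a block costs at most `w.length`, so the penalty `w.length + 1` acts as
  -- infinity.
  have hlt : optimum w < w.length + 1 := by
    obtain ⟨rs, h⟩ := Run.of_splits (.count_true w)
    exact Nat.lt_succ_of_le ((h.best_le _).trans List.count_le_length)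
  obtain ⟨c, h, hc⟩ := (path_trace hlt).plays
  rw [← ofString_eq_cells] at h
  refine ⟨⟨⟨_, c, h, hc⟩, fun j hj => ?_⟩, c, h, hc⟩
  obtain ⟨rs, h⟩ := Run.of_reducibleTo hj
  exact h.best_le _

end Q
end PegSolitaire

/-- There is a single program that, on every one-dimensional Peg Solitaire configuration `w`, halts
within a number of steps linear in the length of `w`, and outputs the minimum number `k` of pegs to
which `w` can be reduced together with a sequence of legal moves that leaves exactly `k` pegs. -/
theorem theorem2 :
    ∃ (P : RAM.Prog) (C : ℕ), ∀ w : List Bool,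
      ∃ (s : RAM.State) (t k : ℕ) (ms : List PegSolitaire.Move) (c' : PegSolitaire.Config),
        RAM.Exec P (RAM.init w) s t ∧
        t ≤ C * (w.length + 1) ∧
        s.out = PegSolitaire.encodeOutput k ms ∧
        IsLeast {j : ℕ | PegSolitaire.ReducibleTo (PegSolitaire.ofString w) j} k ∧
        PegSolitaire.Plays (PegSolitaire.ofString w) ms c' ∧
        c'.card = k := by
  obtain ⟨C, hC⟩ := PegSolitaire.Q.ends_solver
  refine ⟨PegSolitaire.Q.solver, C, fun w => ?_⟩
  obtain ⟨s, t, e, ht, hs⟩ := hC w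
  obtain ⟨hk, c, h, hc⟩ := PegSolitaire.Q.isLeast_optimum w
  exact ⟨s, t, _, _, c, e, ht, hs, hk, h, hc⟩
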